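/- Let $n,m\ge 0$ be integers, $J=\begin{pmatrix}0&I_n\\-I_n&0\end{pmatrix}$ and $Q=\begin{pmatrix}0&I_m\\I_m&0\end{pmatrix}$. Let $Sp_{2n}=\{g\in \mathrm{Mat}_{2n}(\mathbb C): g^tJg=J\}$, with Lie algebra $\mathfrak{sp}_{2n}$, act by left multiplication on $V=(\mathbb C^{2n})^{\oplus 2m}$, regarded as the space of $2n\times 2m$ matrices $X=(X',X'')$ with blocks $X',X''$ of size $2n\times m$. Identify $V$ with the symplectic double $W\oplus W^*$ of $W=(\mathbb C^{2n})^{\oplus m}$ by letting $X''$ correspond to the linear form $Y\mapsto \operatorname{tr}((X'')^tJY)$ on $W$. The moment map of the action is then $$\mu\colon V\to\mathfrak{sp}_{2n}^*,\qquad \mu(X)(A)=\operatorname{tr}\bigl((X'')^tJAX'\bigr).$$ Let $\mathcal I_\mu\subset\mathbb C[V]$ be the ideal generated by the polynomials $X\mapsto\mu(X)(A)$, $A\in\mathfrak{sp}_{2n}$, and let $$\mu^{-1}(0)/\!/Sp_{2n}=\operatorname{Spec}\bigl((\mathbb C[V]/\mathcal I_\mu)^{Sp_{2n}}\bigr)$$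 be the symplectic reduction, considered as the set of its closed points, i.e. of the maximal ideals of $(\mathbb C[V]/\mathcal I_\mu)^{Sp_{2n}}$. Let $\pi$ be the quotient map that sends $X\in V$ with $\mu(X)=0$ to the maximal ideal of all invariants vanishing at $X$. Let $\mathfrak{so}_{2m}=\{A\in\mathrm{Mat}_{2m}(\mathbb C): A^tQ+QA=0\}$ and $$Z=\{A\in\mathfrak{so}_{2m}: A^2=0,\ \operatorname{rk}A\le\min\{2n,m\}\}.$$ Then there is exactly one map $\overline\nu\colon\mu^{-1}(0)/\!/Sp_{2n}\to Z$ with $\overline\nu(\pi(X))=X^tJXQ$ for all $X\in V$ with $\mu(X)=0$, and $\overline\nu$ is a bijection. -/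

import Mathlib

namespace SpReduction

open Matrix MvPolynomial

/-- The matrix `J = (0, I; -I, 0)`. It is the negative of `Matrix.J`, hence defines the same
symplectic group `Matrix.symplecticGroup` and Lie algebra `LieAlgebra.Symplectic.sp`. -/
def J (n : ℕ) : Matrix (Fin n ⊕ Fin n) (Fin n ⊕ Fin n) ℂ := fromBlocks 0 1 (-1) 0

/-- The matrix `Q = (0, I; I, 0)`. -/
def Q (m : ℕ) : Matrix (Fin m ⊕ Fin m) (Fin m ⊕ Fin m) ℂ := fromBlocks 0 1 1 0

/-- The group `Sp_{2n}` over `ℂ`. -/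
abbrev Sp (n : ℕ) := Matrix.symplecticGroup (Fin n) ℂ

/-- The Lie algebra of `Sp_{2n}`. -/
abbrev sp (n : ℕ) := LieAlgebra.Symplectic.sp (Fin n) ℂ

/-- The Lie algebra `{A | Aᵀ Q = - Q A}` of the orthogonal group of `Q`. -/
abbrev so (m : ℕ) := skewAdjointMatricesLieSubalgebra (Q m)

/-- `2n × 2m` matrices `X = (X', X'')`; over `R = ℂ` this is `V = (ℂ^{2n})^{⊕ 2m}`. The columns
indexed by `Sum.inl` form `X'`, those indexed by `Sum.inr` form `X''`. -/
abbrev Mat (n m : ℕ) (R : Type*) := Matrix (Fin n ⊕ Fin n) (Fin m ⊕ Fin m) R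

/-- The coordinate ring `ℂ[V]`. -/
abbrev CoordRing (n m : ℕ) := MvPolynomial ((Fin n ⊕ Fin n) × (Fin m ⊕ Fin m)) ℂ

/-- For `X = (X', X'')` the value `tr(X''ᵀ J A X')`. Here `X''` is regarded as the linear form
`Y ↦ tr(X''ᵀ J Y)` on `(ℂ^{2n})^{⊕ m}`, which identifies `V` with the symplectic double of
`(ℂ^{2n})^{⊕ m}`; so this is `η(Av)` for `v = X'` and `η = X''`. Entries are taken in an arbitrary
`ℂ`-algebra, so that the same formula gives functions and polynomials. -/
def momentForm {n m : ℕ} {R : Type*} [CommRing R] [Algebra ℂ R]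
    (A : Matrix (Fin n ⊕ Fin n) (Fin n ⊕ Fin n) ℂ) (X : Mat n m R) : R :=
  trace (X.toCols₂ᵀ * (J n).map (algebraMap ℂ R) * (A.map (algebraMap ℂ R) * X.toCols₁))

/-- The moment map `μ : V → sp_{2n}^*` of the action of `Sp_{2n}` on `V`. -/
def momentMap {n m : ℕ} (X : Mat n m ℂ) : Module.Dual ℂ (sp n) where
  toFun A := momentForm A.1 X
  map_add' A B := by
    simp [momentForm, Matrix.add_mul, Matrix.mul_add]
  map_smul' c A := by
    simp [momentForm]

/-- The points of the zero fibre `μ⁻¹(0)`. -/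
abbrev ZeroFibre (n m : ℕ) := {X : Mat n m ℂ // momentMap X = 0}

/-- The component of the moment map at `A`, as a polynomial on `V`. -/
noncomputable def momentPoly {n : ℕ} (m : ℕ) (A : sp n) : CoordRing n m :=
  momentForm A.1 (mvPolynomialX (Fin n ⊕ Fin n) (Fin m ⊕ Fin m) ℂ)

/-- The ideal `I_μ` of the (possibly non-reduced) scheme `μ⁻¹(0)`. -/
noncomputable def momentIdeal (n m : ℕ) : Ideal (CoordRing n m) :=
  Ideal.span (Set.range (momentPoly (n := n) m))

/-- The coordinate ring `ℂ[V] / I_μ` of `μ⁻¹(0)`. -/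
abbrev ZeroFibreRing (n m : ℕ) := CoordRing n m ⧸ momentIdeal n m

/-- The action of `g` on polynomials: `f ↦ (X ↦ f (g X))`. -/
noncomputable def act {n : ℕ} (m : ℕ) (g : Sp n) : CoordRing n m →ₐ[ℂ] CoordRing n m :=
  aeval fun p => ((g.1.map (algebraMap ℂ (CoordRing n m)) *
    mvPolynomialX (Fin n ⊕ Fin n) (Fin m ⊕ Fin m) ℂ : Mat n m (CoordRing n m)) p.1 p.2)

theorem momentForm_map {n m : ℕ} {R S : Type*} [CommRing R] [Algebra ℂ R] [CommRing S]
    [Algebra ℂ S] (φ : R →ₐ[ℂ] S) (A : Matrix (Fin n ⊕ Fin n) (Fin n ⊕ Fin n) ℂ)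
    (X : Mat n m R) : φ (momentForm A X) = momentForm A (X.map φ) := by
  have h : ∀ B : Matrix (Fin n ⊕ Fin n) (Fin n ⊕ Fin n) ℂ,
      (B.map (algebraMap ℂ R)).map φ = B.map (algebraMap ℂ S) := by
    intro B; ext; simp
  have h1 : (X.map φ).toCols₁ = X.toCols₁.map φ := rfl
  have h2 : (X.map φ).toCols₂ = X.toCols₂.map φ := rfl
  simp only [momentForm]
  rw [h1, h2, ← h, ← h, ← transpose_map, ← Matrix.map_mul, ← Matrix.map_mul, ← Matrix.map_mul]
  simp only [trace, diag_apply, map_sum, Matrix.map_apply]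

theorem aeval_momentPoly {n m : ℕ} (A : sp n) (X : Mat n m ℂ) :
    aeval (fun p => X p.1 p.2) (momentPoly m A) = momentMap X A := by
  rw [momentPoly, momentForm_map]
  have h : (mvPolynomialX (Fin n ⊕ Fin n) (Fin m ⊕ Fin m) ℂ).map
      (aeval (R := ℂ) fun p => X p.1 p.2) = X := by
    ext; simp
  rw [h]; rfl

theorem J_eq_neg (n : ℕ) : J n = -Matrix.J (Fin n) ℂ := by
  simp [J, Matrix.J, fromBlocks_neg]

theorem conj_mem_sp {n : ℕ} (g : Sp n) (A : sp n) :
    (g⁻¹ : Sp n).1 * A.1 * g.1 ∈ sp n ∧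
      g.1ᵀ * J n * A.1 * g.1 = J n * ((g⁻¹ : Sp n).1 * A.1 * g.1) := by
  have hg : (g⁻¹ : Sp n).1 * g.1 = 1 := by
    exact congrArg Subtype.val (inv_mul_cancel g)
  have hg' : g.1 * (g⁻¹ : Sp n).1 = 1 := by
    exact congrArg Subtype.val (mul_inv_cancel g)
  have hT : g.1ᵀ * Matrix.J (Fin n) ℂ * g.1 = Matrix.J (Fin n) ℂ :=
    SymplecticGroup.mem_iff'.1 g.2
  have hJ : g.1ᵀ * Matrix.J (Fin n) ℂ = Matrix.J (Fin n) ℂ * (g⁻¹ : Sp n).1 := by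
    calc g.1ᵀ * Matrix.J (Fin n) ℂ
        = g.1ᵀ * Matrix.J (Fin n) ℂ * (g.1 * (g⁻¹ : Sp n).1) := by rw [hg', mul_one]
      _ = g.1ᵀ * Matrix.J (Fin n) ℂ * g.1 * (g⁻¹ : Sp n).1 := by simp only [mul_assoc]
      _ = _ := by rw [hT]
  have hJ' : (g⁻¹ : Sp n).1ᵀ * Matrix.J (Fin n) ℂ = Matrix.J (Fin n) ℂ * g.1 := by
    have h3 : (g⁻¹ : Sp n).1ᵀ * Matrix.J (Fin n) ℂ * (g⁻¹ : Sp n).1 = Matrix.J (Fin n) ℂ :=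
      SymplecticGroup.mem_iff'.1 (g⁻¹).2
    calc (g⁻¹ : Sp n).1ᵀ * Matrix.J (Fin n) ℂ
        = (g⁻¹ : Sp n).1ᵀ * Matrix.J (Fin n) ℂ * ((g⁻¹ : Sp n).1 * g.1) := by rw [hg, mul_one]
      _ = (g⁻¹ : Sp n).1ᵀ * Matrix.J (Fin n) ℂ * (g⁻¹ : Sp n).1 * g.1 := by
          simp only [mul_assoc]
      _ = _ := by rw [h3]
  constructor
  · have hA : A.1ᵀ * Matrix.J (Fin n) ℂ = Matrix.J (Fin n) ℂ * (-A.1) := by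
      exact (mem_skewAdjointMatricesSubmodule _ _).1 A.2
    refine (mem_skewAdjointMatricesSubmodule _ _).2 ?_
    change _ * _ = _ * _
    calc ((g⁻¹ : Sp n).1 * A.1 * g.1)ᵀ * Matrix.J (Fin n) ℂ
        = g.1ᵀ * (A.1ᵀ * ((g⁻¹ : Sp n).1ᵀ * Matrix.J (Fin n) ℂ)) := by
          simp only [transpose_mul, mul_assoc]
      _ = g.1ᵀ * (A.1ᵀ * Matrix.J (Fin n) ℂ) * g.1 := by rw [hJ']; simp only [mul_assoc]
      _ = (g.1ᵀ * Matrix.J (Fin n) ℂ) * (-A.1) * g.1 := by rw [hA]; simp only [mul_assoc]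
      _ = _ := by rw [hJ]; simp only [mul_assoc, mul_neg, neg_mul]
  · rw [J_eq_neg]
    simp only [mul_neg, neg_mul, hJ, mul_assoc]

theorem momentForm_mul {n m : ℕ} {R : Type*} [CommRing R] [Algebra ℂ R]
    (g A B : Matrix (Fin n ⊕ Fin n) (Fin n ⊕ Fin n) ℂ) (h : gᵀ * J n * A * g = J n * B)
    (X : Mat n m R) :
    momentForm A (g.map (algebraMap ℂ R) * X : Mat n m R) = momentForm B X := by
  have h1 : (g.map (algebraMap ℂ R) * X : Mat n m R).toCols₁ =
    g.map (algebraMap ℂ R) * X.toCols₁ := rfl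
  have h2 : (g.map (algebraMap ℂ R) * X : Mat n m R).toCols₂ =
    g.map (algebraMap ℂ R) * X.toCols₂ := rfl
  have h3 := congrArg (fun M => M.map (algebraMap ℂ R)) h
  simp only [Matrix.map_mul, transpose_map] at h3
  rw [momentForm, momentForm, h1, h2, transpose_mul]
  congr 1
  calc _ = X.toCols₂ᵀ * ((g.map (algebraMap ℂ R))ᵀ * (J n).map (algebraMap ℂ R) *
        A.map (algebraMap ℂ R) * g.map (algebraMap ℂ R)) * X.toCols₁ := by
        simp only [Matrix.mul_assoc]
    _ = _ := by rw [h3]; simp only [Matrix.mul_assoc]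

theorem act_momentPoly {n : ℕ} (m : ℕ) (g : Sp n) (A : sp n) :
    act m g (momentPoly m A) =
      momentPoly m ⟨(g⁻¹ : Sp n).1 * A.1 * g.1, (conj_mem_sp g A).1⟩ := by
  have h : (mvPolynomialX (Fin n ⊕ Fin n) (Fin m ⊕ Fin m) ℂ).map (act m g) =
      g.1.map (algebraMap ℂ (CoordRing n m)) *
        mvPolynomialX (Fin n ⊕ Fin n) (Fin m ⊕ Fin m) ℂ := by
    ext i j : 2
    rw [Matrix.map_apply, mvPolynomialX_apply, act, aeval_X]
  rw [momentPoly, momentForm_map, h, momentPoly]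
  exact momentForm_mul _ _ _ (conj_mem_sp g A).2 _

theorem momentIdeal_le_comap {n : ℕ} (m : ℕ) (g : Sp n) :
    momentIdeal n m ≤ (momentIdeal n m).comap (act m g) := by
  rw [momentIdeal, Ideal.span_le]
  rintro _ ⟨A, rfl⟩
  rw [SetLike.mem_coe, Ideal.mem_comap, act_momentPoly]
  exact Ideal.subset_span ⟨_, rfl⟩

/-- The induced action of `g` on `ℂ[V] / I_μ`. -/
noncomputable def actQuot {n : ℕ} (m : ℕ) (g : Sp n) :
    ZeroFibreRing n m →ₐ[ℂ] ZeroFibreRing n m :=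
  Ideal.quotientMapₐ (momentIdeal n m) (act m g) (momentIdeal_le_comap m g)

/-- The ring of invariants `(ℂ[V] / I_μ)^{Sp_{2n}}`. -/
noncomputable def invariants (n m : ℕ) : Subalgebra ℂ (ZeroFibreRing n m) :=
  ⨅ g : Sp n, AlgHom.equalizer (actQuot m g) (AlgHom.id ℂ (ZeroFibreRing n m))

/-- The set of closed points of the symplectic reduction
`μ⁻¹(0) // Sp_{2n} = Spec (ℂ[V] / I_μ)^{Sp_{2n}}`. -/
abbrev Reduction (n m : ℕ) := MaximalSpectrum (invariants n m)

/-- Evaluation of functions on the scheme `μ⁻¹(0)` at one of its points. -/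
noncomputable def evalAt {n m : ℕ} (X : ZeroFibre n m) : ZeroFibreRing n m →ₐ[ℂ] ℂ :=
  Ideal.Quotient.liftₐ (momentIdeal n m) (aeval fun p => X.1 p.1 p.2) (by
    have h : momentIdeal n m ≤ RingHom.ker (aeval (R := ℂ) fun p => X.1 p.1 p.2) := by
      rw [momentIdeal, Ideal.span_le]
      rintro _ ⟨A, rfl⟩
      rw [SetLike.mem_coe, RingHom.mem_ker, aeval_momentPoly, X.2]
      rfl
    exact fun a ha => h ha)

/-- The quotient map `μ⁻¹(0) → μ⁻¹(0) // Sp_{2n}` on closed points: `X` is sent to the maximal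
ideal of all invariants that vanish at `X`. -/
noncomputable def quotientMap {n m : ℕ} (X : ZeroFibre n m) : Reduction n m where
  asIdeal := RingHom.ker ((evalAt X).comp (invariants n m).val)
  isMaximal := RingHom.ker_isMaximal_of_surjective _ fun c =>
    ⟨algebraMap ℂ (invariants n m) c, AlgHom.commutes _ c⟩

/-- `Z = {A ∈ so_{2m} | A² = 0, rk A ≤ min {2n, m}}`. -/
def Z (n m : ℕ) : Set (Matrix (Fin m ⊕ Fin m) (Fin m ⊕ Fin m) ℂ) :=
  {A | A ∈ so m ∧ A ^ 2 = 0 ∧ A.rank ≤ min (2 * n) m}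

end SpReduction

namespace SpReduction

open Matrix MvPolynomial

/-! The argument rests on three facts about the Gram matrix $X^tJX$ and the quotient map $\pi$.

First, $\mu(X)=0$ is equivalent to $XQX^t=0$ (`momentMap_eq_zero_iff`). Hence $A=X^tJXQ$ satisfies
$A^2=0$, and its rank is at most $2n$ because it factors through $\mathbb C^{2n}$. Conversely, for
$A\in Z$ the skew matrix $AQ$ is a sum of $r\le n$ hyperbolic terms $pq^t-qp^t$. Placing the $p$'s
and $q$'s along a symplectic system of $\mathbb C^{2n}$ gives a point of the zero fibre over $A$
(`exists_zeroFibre_gram_eq`).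

Second, $\pi(X)=\pi(Y)$ exactly when the Gram matrices agree (`quotientMap_eq_iff`). Gram entries
are invariants, which gives one direction. For the other, a one-parameter degeneration in $Sp_{2n}$
shrinks $X$, without changing any invariant or the Gram matrix, until its kernel contains that of
the Gram matrix. Such points with equal Gram matrix are conjugate by Witt's theorem.

Third, $\pi$ is surjective (`quotientMap_surjective`). By the Nullstellensatz it suffices that a
proper ideal of invariants extends to a proper ideal of $\mathbb C[V]/\mathcal I_\mu$
(`map_val_ne_top`). In place of a Reynolds operator, the derivations of $\mathbb C[V]$ defined by
$x\mapsto\omega(v,x)v$ are used: for the Fischer inner product this family is closed under negative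
adjoints, so a polynomial is a joint-kernel element plus a sum of images of the derivations. Group
and derivations are linked by transvections, which generate $Sp_{2n}$ and are affine in their
parameter. -/

/-! ### The symplectic form and transvections -/

/-- The symplectic form `ω(x, y) = xᵀ J y`. -/
noncomputable abbrev ω {n : ℕ} : LinearMap.BilinForm ℂ (Fin n ⊕ Fin n → ℂ) := Matrix.toBilin' (J n)

theorem J_transpose (n : ℕ) : (J n)ᵀ = -J n := by
  rw [J_eq_neg, transpose_neg, Matrix.J_transpose]

theorem J_mul_J (n : ℕ) : J n * J n = -1 := by
  rw [J_eq_neg, neg_mul_neg, Matrix.J_squared]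

theorem ω_apply {n : ℕ} (x y : Fin n ⊕ Fin n → ℂ) : ω x y = x ⬝ᵥ J n *ᵥ y :=
  Matrix.toBilin'_apply' _ _ _

theorem ω_swap {n : ℕ} (x y : Fin n ⊕ Fin n → ℂ) : ω y x = -ω x y := by
  rw [ω_apply, ω_apply, dotProduct_mulVec, ← mulVec_transpose, J_transpose, neg_mulVec,
    neg_dotProduct, dotProduct_comm]

theorem ω_self {n : ℕ} (x : Fin n ⊕ Fin n → ℂ) : ω x x = 0 :=
  self_eq_neg.1 (ω_swap x x)

theorem exists_ω_eq_one {n : ℕ} {u : Fin n ⊕ Fin n → ℂ} (hu : u ≠ 0) : ∃ w, ω w u = 1 := by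
  have h : J n *ᵥ u ≠ 0 := fun h => hu <| by
    have := congrArg (J n *ᵥ ·) h
    simpa [mulVec_mulVec, J_mul_J, neg_mulVec] using this
  obtain ⟨i, hi⟩ := Function.ne_iff.1 h
  refine ⟨Pi.single i ((J n *ᵥ u) i)⁻¹, ?_⟩
  rw [ω_apply, single_dotProduct, inv_mul_cancel₀ hi]

theorem mem_Sp_iff {n : ℕ} {g : Matrix (Fin n ⊕ Fin n) (Fin n ⊕ Fin n) ℂ} :
    g ∈ Sp n ↔ gᵀ * J n * g = J n := by
  rw [SymplecticGroup.mem_iff', J_eq_neg]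
  simp

theorem mem_Sp_iff_ω {n : ℕ} {g : Matrix (Fin n ⊕ Fin n) (Fin n ⊕ Fin n) ℂ} :
    g ∈ Sp n ↔ ∀ x y, ω (g *ᵥ x) (g *ᵥ y) = ω x y := by
  have key : ∀ x y, ω (g *ᵥ x) (g *ᵥ y) = toBilin' (gᵀ * J n * g) x y := by
    intro x y
    rw [ω_apply, toBilin'_apply', ← mulVec_mulVec, ← mulVec_mulVec, dotProduct_mulVec x,
      vecMul_transpose]
  rw [mem_Sp_iff]
  refine ⟨fun h x y => by rw [key, h], fun h => ?_⟩
  apply (Matrix.toBilin' (R₁ := ℂ)).injective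
  exact LinearMap.ext fun x => LinearMap.ext fun y => by rw [← key, h]

/-- The symplectic transvection `x ↦ x + c ω(v, x) v`. -/
noncomputable def transvectionMatrix {n : ℕ} (c : ℂ) (v : Fin n ⊕ Fin n → ℂ) :
    Matrix (Fin n ⊕ Fin n) (Fin n ⊕ Fin n) ℂ :=
  1 + c • vecMulVec v (v ᵥ* J n)

theorem transvectionMatrix_mulVec {n : ℕ} (c : ℂ) (v x : Fin n ⊕ Fin n → ℂ) :
    transvectionMatrix c v *ᵥ x = x + (c * ω v x) • v := by
  rw [transvectionMatrix, add_mulVec, one_mulVec, smul_mulVec, vecMulVec_mulVec, ω_apply,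
    dotProduct_mulVec, mul_smul, op_smul_eq_smul]

theorem transvectionMatrix_mem {n : ℕ} (c : ℂ) (v : Fin n ⊕ Fin n → ℂ) :
    transvectionMatrix c v ∈ Sp n := by
  rw [mem_Sp_iff_ω]
  intro x y
  simp only [transvectionMatrix_mulVec, map_add, map_smul, LinearMap.add_apply,
    LinearMap.smul_apply, smul_eq_mul, ω_self, ω_swap v x]
  ring

/-- The symplectic transvection `x ↦ x + c ω(v, x) v` as an element of `Sp_{2n}`. -/
noncomputable def transvection {n : ℕ} (c : ℂ) (v : Fin n ⊕ Fin n → ℂ) : Sp n :=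
  ⟨transvectionMatrix c v, transvectionMatrix_mem c v⟩

/-- The subgroup of `Sp_{2n}` generated by the symplectic transvections. -/
noncomputable def transvectionGroup (n : ℕ) : Subgroup (Sp n) :=
  Subgroup.closure (Set.range fun p : ℂ × (Fin n ⊕ Fin n → ℂ) => transvection p.1 p.2)

theorem transvection_mem {n : ℕ} (c : ℂ) (v : Fin n ⊕ Fin n → ℂ) :
    transvection c v ∈ transvectionGroup n :=
  Subgroup.subset_closure ⟨(c, v), rfl⟩

/-- The direction $u-v$ is forced; since $\omega(u-v,u)=\omega(u,v)$, the coefficient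
$-\omega(u,v)^{-1}$ carries $u$ to $v$. -/
theorem exists_transvection_of_ω_ne_zero {n : ℕ} {u v : Fin n ⊕ Fin n → ℂ} (h : ω u v ≠ 0) :
    ∃ g ∈ transvectionGroup n, g.1 *ᵥ u = v ∧ ∀ x, ω (u - v) x = 0 → g.1 *ᵥ x = x := by
  refine ⟨_, transvection_mem (-(ω u v)⁻¹) (u - v), ?_, fun x hx => ?_⟩
  · change transvectionMatrix _ _ *ᵥ u = v
    rw [transvectionMatrix_mulVec]
    have : ω (u - v) u = ω u v := by simp [ω_self, ω_swap u v]
    rw [this, neg_mul, inv_mul_cancel₀ h]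
    simp
  · change transvectionMatrix _ _ *ᵥ x = x
    rw [transvectionMatrix_mulVec, hx]
    simp

/-- If $\omega(u,v)=0$, one passes through a vector $w$ pairing nontrivially with both. One of $u'$,
$v'$, $u'+v'$ always works, and it is orthogonal to $S$, so both transvections fix $S$. -/
theorem exists_transvectionGroup_map_vector {n : ℕ} (S : Set (Fin n ⊕ Fin n → ℂ))
    {u u' v v' : Fin n ⊕ Fin n → ℂ} (hu : ∀ s ∈ S, ω u s = 0) (hu' : ∀ s ∈ S, ω u' s = 0)
    (hv : ∀ s ∈ S, ω v s = 0) (hv' : ∀ s ∈ S, ω v' s = 0) (huu : ω u u' = 1) (hvv : ω v v' = 1) :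
    ∃ g ∈ transvectionGroup n, g.1 *ᵥ u = v ∧ ∀ s ∈ S, g.1 *ᵥ s = s := by
  by_cases huv : ω u v = 0
  · obtain ⟨w, hw, h1, h2⟩ : ∃ w, (∀ s ∈ S, ω w s = 0) ∧ ω u w ≠ 0 ∧ ω w v ≠ 0 := by
      by_cases h1 : ω v u' = 0
      · by_cases h2 : ω u v' = 0
        · refine ⟨u' + v', fun s hs => by simp [hu' s hs, hv' s hs], ?_, ?_⟩
          · simp [huu, h2]
          · rw [ω_swap]; simp [hvv, h1]
        · refine ⟨v', hv', h2, ?_⟩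
          rw [ω_swap, hvv]; simp
      · refine ⟨u', hu', by simp [huu], ?_⟩
        rw [ω_swap]; simpa using h1
    obtain ⟨g, hg, hgu, hgs⟩ := exists_transvection_of_ω_ne_zero h1
    obtain ⟨k, hk, hku, hks⟩ := exists_transvection_of_ω_ne_zero h2
    refine ⟨k * g, mul_mem hk hg, ?_, fun s hs => ?_⟩
    · change (k.1 * g.1) *ᵥ u = v
      rw [← mulVec_mulVec, hgu, hku]
    · change (k.1 * g.1) *ᵥ s = s
      rw [← mulVec_mulVec, hgs, hks]
      · simp [hw s hs, hv s hs]
      · simp [hw s hs, hu s hs]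
  · obtain ⟨g, hg, hgu, hgs⟩ := exists_transvection_of_ω_ne_zero huv
    exact ⟨g, hg, hgu, fun s hs => hgs s (by simp [hu s hs, hv s hs])⟩

theorem exists_transvectionGroup_map_partner {n : ℕ} (S : Set (Fin n ⊕ Fin n → ℂ))
    {u a b : Fin n ⊕ Fin n → ℂ} (hu : ∀ s ∈ S, ω u s = 0) (ha : ∀ s ∈ S, ω a s = 0)
    (hb : ∀ s ∈ S, ω b s = 0) (hua : ω u a = 1) (hub : ω u b = 1) :
    ∃ g ∈ transvectionGroup n, g.1 *ᵥ u = u ∧ g.1 *ᵥ a = b ∧ ∀ s ∈ S, g.1 *ᵥ s = s := by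
  have hau : ω a u = -1 := by rw [ω_swap, hua]
  have hbu : ω b u = -1 := by rw [ω_swap, hub]
  by_cases hab : ω a b = 0
  -- The detour through $u+a$ keeps $u$ fixed: both directions $-u$ and $u+a-b$ are orthogonal to
  -- $u$.
  · obtain ⟨g, hg, hgu, hgs⟩ := exists_transvection_of_ω_ne_zero (u := a) (v := u + a)
      (by simp [ω_self, hau])
    obtain ⟨k, hk, hku, hks⟩ := exists_transvection_of_ω_ne_zero (u := u + a) (v := b)
      (by simp [hub, hab])
    refine ⟨k * g, mul_mem hk hg, ?_, ?_, fun s hs => ?_⟩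
    · change (k.1 * g.1) *ᵥ u = u
      rw [← mulVec_mulVec, hgs, hks] <;> simp [ω_self, hau, hbu]
    · change (k.1 * g.1) *ᵥ a = b
      rw [← mulVec_mulVec, hgu, hku]
    · change (k.1 * g.1) *ᵥ s = s
      rw [← mulVec_mulVec, hgs, hks] <;> simp [hu s hs, ha s hs, hb s hs]
  · obtain ⟨g, hg, hgu, hgs⟩ := exists_transvection_of_ω_ne_zero hab
    exact ⟨g, hg, hgs u (by simp [hau, hbu]), hgu, fun s hs => hgs s (by simp [ha s hs, hb s hs])⟩

/-! ### Witt's theorem and generation by transvections -/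

/-- Families `e, f` of vectors with `ω(eᵢ, fⱼ) = δᵢⱼ` and `ω(eᵢ, eⱼ) = ω(fᵢ, fⱼ) = 0`. -/
structure IsSymplecticSystem {n k : ℕ} (e f : Fin k → Fin n ⊕ Fin n → ℂ) : Prop where
  left : ∀ i j, ω (e i) (e j) = 0
  right : ∀ i j, ω (f i) (f j) = 0
  pair : ∀ i j, ω (e i) (f j) = if i = j then 1 else 0

theorem IsSymplecticSystem.map {n k : ℕ} {e f : Fin k → Fin n ⊕ Fin n → ℂ}
    (h : IsSymplecticSystem e f) (g : Sp n) :
    IsSymplecticSystem (fun i => g.1 *ᵥ e i) (fun i => g.1 *ᵥ f i) := by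
  have hg := mem_Sp_iff_ω.1 g.2
  exact ⟨fun i j => by rw [hg, h.left], fun i j => by rw [hg, h.right],
    fun i j => by rw [hg, h.pair]⟩

theorem IsSymplecticSystem.tail {n k : ℕ} {e f : Fin (k + 1) → Fin n ⊕ Fin n → ℂ}
    (h : IsSymplecticSystem e f) :
    IsSymplecticSystem (fun i => e (Fin.succ i)) (fun i => f (Fin.succ i)) :=
  ⟨fun i j => h.left _ _, fun i j => h.right _ _, fun i j => by rw [h.pair]; simp⟩

/-- Witt's theorem: the group generated by the transvections acts transitively on symplectic
systems of a given length. -/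
theorem IsSymplecticSystem.exists_transvectionGroup {n : ℕ} :
    ∀ {k : ℕ} {e f e' f' : Fin k → Fin n ⊕ Fin n → ℂ}, IsSymplecticSystem e f →
      IsSymplecticSystem e' f' →
      ∃ g ∈ transvectionGroup n, ∀ i, g.1 *ᵥ e i = e' i ∧ g.1 *ᵥ f i = f' i
  | 0, _, _, _, _, _, _ => ⟨1, one_mem _, fun i => i.elim0⟩
  | k + 1, e, f, e', f', h, h' => by
    obtain ⟨g, hg, hgi⟩ := h.tail.exists_transvectionGroup h'.tail
    have h1 := h.map g
    -- The tails are already matched by `g`. The remaining hyperbolic pair is moved by transvections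
    -- that fix `S`, the set of tail vectors.
    let S : Set (Fin n ⊕ Fin n → ℂ) := {s | ∃ i : Fin k, s = e' i.succ ∨ s = f' i.succ}
    have hu : ∀ s ∈ S, ω (g.1 *ᵥ e 0) s = 0 := by
      rintro s ⟨i, rfl | rfl⟩
      · rw [← (hgi i).1]; exact h1.left _ _
      · rw [← (hgi i).2]; exact (h1.pair _ _).trans (if_neg (Fin.succ_ne_zero i).symm)
    have hu' : ∀ s ∈ S, ω (g.1 *ᵥ f 0) s = 0 := by
      rintro s ⟨i, rfl | rfl⟩
      · rw [← (hgi i).1, ω_swap, neg_eq_zero]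
        exact (h1.pair _ _).trans (if_neg (Fin.succ_ne_zero i))
      · rw [← (hgi i).2]; exact h1.right _ _
    have hv : ∀ s ∈ S, ω (e' 0) s = 0 := by
      rintro s ⟨i, rfl | rfl⟩
      · exact h'.left _ _
      · exact (h'.pair _ _).trans (if_neg (Fin.succ_ne_zero i).symm)
    have hv' : ∀ s ∈ S, ω (f' 0) s = 0 := by
      rintro s ⟨i, rfl | rfl⟩
      · rw [ω_swap, neg_eq_zero]
        exact (h'.pair _ _).trans (if_neg (Fin.succ_ne_zero i))
      · exact h'.right _ _
    have huu : ω (g.1 *ᵥ e 0) (g.1 *ᵥ f 0) = 1 := (h1.pair 0 0).trans (if_pos rfl)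
    have hvv : ω (e' 0) (f' 0) = 1 := (h'.pair 0 0).trans (if_pos rfl)
    obtain ⟨k1, hk1, hk1u, hk1s⟩ := exists_transvectionGroup_map_vector S hu hu' hv hv' huu hvv
    have ha : ∀ s ∈ S, ω (k1.1 *ᵥ g.1 *ᵥ f 0) s = 0 := by
      intro s hs
      rw [← hk1s s hs, mem_Sp_iff_ω.1 k1.2, hu' s hs]
    have hva : ω (e' 0) (k1.1 *ᵥ g.1 *ᵥ f 0) = 1 := by
      rw [← hk1u, mem_Sp_iff_ω.1 k1.2, huu]
    obtain ⟨k2, hk2, hk2u, hk2a, hk2s⟩ :=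
      exists_transvectionGroup_map_partner S hv ha hv' hva hvv
    refine ⟨k2 * k1 * g, mul_mem (mul_mem hk2 hk1) hg, fun i => ?_⟩
    have hmul : ∀ x, (k2 * k1 * g).1 *ᵥ x = k2.1 *ᵥ k1.1 *ᵥ g.1 *ᵥ x := by
      intro x
      rw [mulVec_mulVec, mulVec_mulVec]
      rfl
    rw [hmul, hmul]
    induction i using Fin.cases with
    | zero => exact ⟨by rw [hk1u, hk2u], hk2a⟩
    | succ i =>
      rw [(hgi i).1, (hgi i).2, hk1s _ ⟨i, .inl rfl⟩, hk2s _ ⟨i, .inl rfl⟩,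
        hk1s _ ⟨i, .inr rfl⟩, hk2s _ ⟨i, .inr rfl⟩]
      exact ⟨rfl, rfl⟩

theorem isSymplecticSystem_single {n r : ℕ} (h : r ≤ n) :
    IsSymplecticSystem (n := n) (fun i : Fin r => Pi.single (Sum.inl (Fin.castLE h i)) 1)
      (fun i => Pi.single (Sum.inr (Fin.castLE h i)) 1) := by
  constructor <;> intro i j <;> rw [Matrix.toBilin'_single] <;> simp [J, Matrix.one_apply]

/-- Witt's theorem, applied to the standard basis and its image under $g$, gives a product of
transvections with the same columns as $g$. -/
theorem transvectionGroup_eq_top (n : ℕ) : transvectionGroup n = ⊤ := by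
  rw [eq_top_iff]
  intro g _
  have h := isSymplecticSystem_single (le_refl n)
  obtain ⟨k, hk, hkg⟩ := h.exists_transvectionGroup (h.map g)
  have : k = g := by
    apply Subtype.ext
    ext i j
    rcases j with j | j
    · simpa using congrFun (hkg j).1 i
    · simpa using congrFun (hkg j).2 i
  exact this ▸ hk

/-! ### Normal form of skew-symmetric matrices -/

/-- `B = ∑ᵢ (pᵢ qᵢᵀ - qᵢ pᵢᵀ)`, where `p, q` are linearly independent; independence is witnessed by
the families `a, b` dual to `p, q`. -/
structure IsSkewDecomposition {κ : Type*} [Fintype κ] {r : ℕ} (B : Matrix κ κ ℂ)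
    (p q a b : Fin r → κ → ℂ) : Prop where
  eq_sum : B = ∑ i, (vecMulVec (p i) (q i) - vecMulVec (q i) (p i))
  p_a : ∀ i j, p i ⬝ᵥ a j = if i = j then 1 else 0
  p_b : ∀ i j, p i ⬝ᵥ b j = 0
  q_a : ∀ i j, q i ⬝ᵥ a j = 0
  q_b : ∀ i j, q i ⬝ᵥ b j = if i = j then 1 else 0

namespace IsSkewDecomposition

variable {κ : Type*} [Fintype κ] {r : ℕ} {B : Matrix κ κ ℂ} {p q a b : Fin r → κ → ℂ}

theorem mulVec_eq (h : IsSkewDecomposition B p q a b) (x : κ → ℂ) :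
    B *ᵥ x = ∑ i, ((q i ⬝ᵥ x) • p i - (p i ⬝ᵥ x) • q i) := by
  rw [h.eq_sum, sum_mulVec]
  simp [sub_mulVec, vecMulVec_mulVec]

theorem a_dotProduct (h : IsSkewDecomposition B p q a b) (i : Fin r) (x : κ → ℂ) :
    a i ⬝ᵥ B *ᵥ x = q i ⬝ᵥ x := by
  rw [h.mulVec_eq, dotProduct_sum]
  simp [dotProduct_comm (a i), h.p_a, h.q_a]

theorem b_dotProduct (h : IsSkewDecomposition B p q a b) (i : Fin r) (x : κ → ℂ) :
    b i ⬝ᵥ B *ᵥ x = -(p i ⬝ᵥ x) := by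
  rw [h.mulVec_eq, dotProduct_sum]
  simp [dotProduct_comm (b i), h.p_b, h.q_b]

/-- Restricting the form $B$ to the span of the dual vectors $a,b$ gives the invertible matrix $J$
of size $2r$. -/
theorem two_mul_le_rank (h : IsSkewDecomposition B p q a b) : 2 * r ≤ B.rank := by
  let N : Matrix κ (Fin r ⊕ Fin r) ℂ := (of (Sum.elim a b))ᵀ
  have hN : Nᵀ * (B * N) = J r := by
    ext i j
    have : (Nᵀ * (B * N)) i j = Sum.elim a b i ⬝ᵥ B *ᵥ Sum.elim a b j := rfl
    rw [this]
    rcases i with i | i <;> rcases j with j | j <;>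
      simp [h.a_dotProduct, h.b_dotProduct, h.p_a, h.p_b, h.q_a, h.q_b, J, Matrix.one_apply]
  have hJ : (J r).rank = 2 * r := by
    rw [rank_of_isUnit]
    · simp [two_mul]
    · rw [J_eq_neg, IsUnit.neg_iff, Matrix.isUnit_iff_isUnit_det]
      exact Matrix.isUnit_det_J _ _
  rw [← hJ, ← hN]
  exact (rank_mul_le_right _ _).trans (rank_mul_le_left _ _)

end IsSkewDecomposition

theorem dotProduct_mulVec_swap {κ : Type*} [Fintype κ] {B : Matrix κ κ ℂ} (hB : Bᵀ = -B)
    (x y : κ → ℂ) : x ⬝ᵥ B *ᵥ y = -(y ⬝ᵥ B *ᵥ x) := by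
  rw [dotProduct_mulVec, ← mulVec_transpose, hB, neg_mulVec, neg_dotProduct, dotProduct_comm]

theorem dotProduct_mulVec_self {κ : Type*} [Fintype κ] {B : Matrix κ κ ℂ} (hB : Bᵀ = -B)
    (x : κ → ℂ) : x ⬝ᵥ B *ᵥ x = 0 :=
  self_eq_neg.1 (dotProduct_mulVec_swap hB x x)

/-- Every skew-symmetric matrix has a symplectic normal form. -/
theorem exists_isSkewDecomposition {κ : Type*} [Fintype κ] [DecidableEq κ] (B : Matrix κ κ ℂ)
    (hB : Bᵀ = -B) :
    ∃ (r : ℕ) (p q a b : Fin r → κ → ℂ), IsSkewDecomposition B p q a b := by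
  by_cases h0 : B = 0
  · exact ⟨0, Fin.elim0, Fin.elim0, Fin.elim0, Fin.elim0, by simpa using h0,
      fun i => i.elim0, fun i => i.elim0, fun i => i.elim0, fun i => i.elim0⟩
  obtain ⟨a, b, hab⟩ : ∃ a b, a ⬝ᵥ B *ᵥ b = 1 := by
    obtain ⟨i, j, hij⟩ : ∃ i j, B i j ≠ 0 := by
      by_contra! h
      exact h0 (by ext i j; exact h i j)
    refine ⟨Pi.single i 1, Pi.single j (B i j)⁻¹, ?_⟩
    rw [single_dotProduct, mulVec_single]
    simp [hij]
  have hba : b ⬝ᵥ B *ᵥ a = -1 := by rw [dotProduct_mulVec_swap hB, hab]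
  have haa := dotProduct_mulVec_self hB a
  have hbb := dotProduct_mulVec_self hB b
  obtain ⟨q, hq⟩ : ∃ q, q = B *ᵥ a := ⟨_, rfl⟩
  obtain ⟨p, hp⟩ : ∃ p, p = B *ᵥ b := ⟨_, rfl⟩
  rw [← hp] at hab hbb
  rw [← hq] at hba haa
  -- Splitting off the hyperbolic plane spanned by $a,b$: the remaining form $C$ has both vectors in
  -- its kernel.
  obtain ⟨C, hC⟩ : ∃ C, C = B - (vecMulVec q p - vecMulVec p q) := ⟨_, rfl⟩
  have hCt : Cᵀ = -C := by
    rw [hC]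
    simp only [transpose_sub, hB, transpose_vecMulVec]
    abel
  have hCx : ∀ x, C *ᵥ x = B *ᵥ x - ((p ⬝ᵥ x) • q - (q ⬝ᵥ x) • p) := by
    intro x
    simp [hC, sub_mulVec, vecMulVec_mulVec]
  have hCa : C *ᵥ a = 0 := by
    rw [hCx, ← hq, dotProduct_comm p, hab, dotProduct_comm q, haa]; simp
  have hCb : C *ᵥ b = 0 := by
    rw [hCx, ← hp, dotProduct_comm p, hbb, dotProduct_comm q, hba]; simp
  -- The range of $C$ lies in that of $B$ but misses $p=Bb$: from $Cx=p$ and $Ca=0$ one would get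
  -- $1=a^tCx=0$.
  have hrank : C.rank < B.rank := by
    refine Submodule.finrank_lt_finrank_of_lt (lt_of_le_of_ne ?_ fun heq => ?_)
    · rintro _ ⟨x, rfl⟩
      refine ⟨x - (p ⬝ᵥ x) • a + (q ⬝ᵥ x) • b, ?_⟩
      simp only [mulVecLin_apply, hCx, mulVec_add, mulVec_sub, mulVec_smul, ← hp, ← hq]
      abel
    · have : p ∈ LinearMap.range C.mulVecLin := heq ▸ ⟨b, hp.symm⟩
      obtain ⟨x, hx⟩ := this
      rw [mulVecLin_apply] at hx
      rw [← hx, dotProduct_mulVec_swap hCt, hCa] at hab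
      simp at hab
  obtain ⟨r, p₁, q₁, a₁, b₁, h⟩ := exists_isSkewDecomposition C hCt
  have hp₁a : ∀ i, p₁ i ⬝ᵥ a = 0 := fun i => by
    have := h.b_dotProduct i a; rw [hCa] at this; simpa using this.symm
  have hq₁a : ∀ i, q₁ i ⬝ᵥ a = 0 := fun i => by
    have := h.a_dotProduct i a; rw [hCa] at this; simpa using this.symm
  have hp₁b : ∀ i, p₁ i ⬝ᵥ b = 0 := fun i => by
    have := h.b_dotProduct i b; rw [hCb] at this; simpa using this.symm
  have hq₁b : ∀ i, q₁ i ⬝ᵥ b = 0 := fun i => by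
    have := h.a_dotProduct i b; rw [hCb] at this; simpa using this.symm
  rw [dotProduct_comm] at hab hba haa hbb
  -- The old dual vectors are corrected within the span of $a,b$ to annihilate $p$ and $q$. Pairings
  -- with $p_1,q_1$ do not change, since these vanish on $a,b$. The sign in $-b$ comes from $q\cdot
  -- b=-1$.
  refine ⟨r + 1, Fin.cons q p₁, Fin.cons p q₁,
    Fin.cons (-b) fun j => a₁ j + (q ⬝ᵥ a₁ j) • b - (p ⬝ᵥ a₁ j) • a,
    Fin.cons a fun j => b₁ j + (q ⬝ᵥ b₁ j) • b - (p ⬝ᵥ b₁ j) • a, ?_, ?_, ?_, ?_, ?_⟩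
  · rw [Fin.sum_univ_succ]
    simp only [Fin.cons_zero, Fin.cons_succ]
    rw [← h.eq_sum, hC]
    abel
  all_goals
    intro i j
    induction i using Fin.cases <;> induction j using Fin.cases <;>
      simp [dotProduct_add, dotProduct_sub, hab, hba, haa, hbb, hp₁a, hp₁b, hq₁a, hq₁b,
        h.p_a, h.p_b, h.q_a, h.q_b, Fin.succ_ne_zero, (Fin.succ_ne_zero _).symm]
termination_by B.rank

/-! ### The zero fibre and its image in Z -/

theorem Q_transpose (m : ℕ) : (Q m)ᵀ = Q m := by
  simp [Q, fromBlocks_transpose]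

theorem Q_mul_Q (m : ℕ) : Q m * Q m = 1 := by
  simp [Q, fromBlocks_multiply]

theorem mul_Q_mul_transpose {n m : ℕ} (X : Mat n m ℂ) :
    X * Q m * Xᵀ = X.toCols₁ * X.toCols₂ᵀ + X.toCols₂ * X.toCols₁ᵀ := by
  ext i j
  simp [mul_apply, Q, Fintype.sum_sum_type, fromBlocks, Matrix.one_apply, toCols₁, toCols₂,
    add_comm]

theorem J_mul_symm {n : ℕ} (A : sp n) : (J n * A.1)ᵀ = J n * A.1 := by
  have hA : A.1ᵀ * Matrix.J (Fin n) ℂ = Matrix.J (Fin n) ℂ * (-A.1) :=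
    (mem_skewAdjointMatricesSubmodule _ _).1 A.2
  rw [transpose_mul, J_transpose, J_eq_neg, neg_neg, hA]
  simp

/-- Since $JA$ is symmetric, transposition shows that $X'X''^t$ and $X''X'^t$ have the same trace
against it, and their sum is $XQX^t$. -/
theorem two_mul_momentForm {n m : ℕ} (A : sp n) (X : Mat n m ℂ) :
    2 * momentForm A.1 X = trace (J n * A.1 * (X * Q m * Xᵀ)) := by
  have hid : ∀ B : Matrix (Fin n ⊕ Fin n) (Fin n ⊕ Fin n) ℂ, B.map (algebraMap ℂ ℂ) = B :=
    fun B => rfl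
  have h1 : momentForm A.1 X = trace (J n * A.1 * (X.toCols₁ * X.toCols₂ᵀ)) := by
    rw [momentForm, hid, hid, Matrix.mul_assoc, trace_mul_comm]
    simp only [Matrix.mul_assoc]
  have h2 : trace (J n * A.1 * (X.toCols₁ * X.toCols₂ᵀ)) =
      trace (J n * A.1 * (X.toCols₂ * X.toCols₁ᵀ)) := by
    rw [← trace_transpose, transpose_mul, J_mul_symm, trace_mul_comm, transpose_mul,
      transpose_transpose]
  rw [mul_Q_mul_transpose, Matrix.mul_add, trace_add, ← h2, ← h1, two_mul]

theorem eq_zero_of_dotProduct_mulVec_self {κ : Type*} [Fintype κ] [DecidableEq κ]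
    {S : Matrix κ κ ℂ} (hS : Sᵀ = S) (h : ∀ w, w ⬝ᵥ S *ᵥ w = 0) : S = 0 := by
  have hp : ∀ x y, x ⬝ᵥ S *ᵥ y = 0 := by
    intro x y
    have hs : y ⬝ᵥ S *ᵥ x = x ⬝ᵥ S *ᵥ y := by
      rw [dotProduct_mulVec, ← mulVec_transpose, hS, dotProduct_comm]
    have := h (x + y)
    rw [mulVec_add, dotProduct_add, add_dotProduct, add_dotProduct, h, h, hs] at this
    simpa using this
  ext i j
  simpa using hp (Pi.single i 1) (Pi.single j 1)

/-- The matrices $JA$ include every $ww^t$, and a symmetric matrix whose quadratic form vanishes is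
zero. -/
theorem momentMap_eq_zero_iff {n m : ℕ} (X : Mat n m ℂ) :
    momentMap X = 0 ↔ X * Q m * Xᵀ = 0 := by
  have hmm : ∀ A : sp n, 2 * momentMap X A = trace (J n * A.1 * (X * Q m * Xᵀ)) :=
    fun A => two_mul_momentForm A X
  constructor
  · intro h
    refine eq_zero_of_dotProduct_mulVec_self ?_ fun w => ?_
    · simp only [transpose_mul, transpose_transpose, Q_transpose, Matrix.mul_assoc]
    -- Since $J^2=-1$, this choice of $A$ gives $JA=ww^t$, so the trace formula returns $w^tXQX^tw$.
    · have hA : -J n * vecMulVec w w ∈ sp n := by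
        refine (mem_skewAdjointMatricesSubmodule _ _).2 ?_
        change _ * _ = _ * _
        rw [show Matrix.J (Fin n) ℂ = -J n by rw [J_eq_neg, neg_neg]]
        simp only [transpose_mul, transpose_neg, J_transpose, transpose_vecMulVec, neg_neg, neg_mul,
          mul_neg, Matrix.mul_assoc, J_mul_J]
        rw [← Matrix.mul_assoc, J_mul_J]
        simp
      have := hmm ⟨_, hA⟩
      rw [h, LinearMap.zero_apply, mul_zero] at this
      have hJ : J n * (-J n * vecMulVec w w) = vecMulVec w w := by
        rw [← Matrix.mul_assoc, mul_neg, J_mul_J, neg_neg, one_mul]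
      rw [hJ, trace_mul_comm, mul_vecMulVec, trace_vecMulVec, dotProduct_comm] at this
      simpa using this.symm
  · intro h
    ext A
    have := hmm A
    rw [h] at this
    simpa using this

theorem gram_transpose {n m : ℕ} (X : Mat n m ℂ) : (Xᵀ * J n * X)ᵀ = -(Xᵀ * J n * X) := by
  simp [transpose_mul, J_transpose, Matrix.mul_assoc]

theorem dotProduct_gram_mulVec {n m : ℕ} (X : Mat n m ℂ) (x y : Fin m ⊕ Fin m → ℂ) :
    x ⬝ᵥ (Xᵀ * J n * X) *ᵥ y = ω (X *ᵥ x) (X *ᵥ y) := by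
  rw [ω_apply, ← mulVec_mulVec, ← mulVec_mulVec, dotProduct_mulVec x, vecMul_transpose]

theorem mem_so_iff {m : ℕ} (A : Matrix (Fin m ⊕ Fin m) (Fin m ⊕ Fin m) ℂ) :
    A ∈ so m ↔ (A * Q m)ᵀ = -(A * Q m) := by
  have h : A ∈ so m ↔ Aᵀ * Q m = Q m * (-A) := mem_skewAdjointMatricesSubmodule _ _
  rw [h, transpose_mul, Q_transpose]
  constructor
  · intro h
    calc Q m * Aᵀ = Q m * (Aᵀ * Q m) * Q m := by
          simp only [Matrix.mul_assoc, Q_mul_Q, Matrix.mul_one]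
      _ = -(A * Q m) := by
          rw [h, ← Matrix.mul_assoc, Q_mul_Q]; simp
  · intro h
    calc Aᵀ * Q m = Q m * (Q m * Aᵀ) * Q m := by
          rw [← Matrix.mul_assoc, Q_mul_Q]; simp
      _ = _ := by
          rw [h, mul_neg, neg_mul, Matrix.mul_assoc, Matrix.mul_assoc, Q_mul_Q]; simp

/-- The range lies in the kernel, inside a space of dimension $2m$. Thus the bound by $m$ in the
definition of `Z` is automatic. -/
theorem rank_le_of_sq_eq_zero {m : ℕ} {A : Matrix (Fin m ⊕ Fin m) (Fin m ⊕ Fin m) ℂ}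
    (hA : A ^ 2 = 0) : A.rank ≤ m := by
  have h := rank_add_rank_le_card_of_mul_eq_zero (A := A) (B := A) (by rw [← sq, hA])
  simp at h
  omega

theorem gram_mul_Q_mem_Z {n m : ℕ} (X : ZeroFibre n m) : X.1ᵀ * J n * X.1 * Q m ∈ Z n m := by
  have h2 : (X.1ᵀ * J n * X.1 * Q m) ^ 2 = 0 := by
    have h := (momentMap_eq_zero_iff X.1).1 X.2
    calc (X.1ᵀ * J n * X.1 * Q m) ^ 2
        = X.1ᵀ * J n * (X.1 * Q m * X.1ᵀ) * J n * X.1 * Q m := by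
          simp only [sq, Matrix.mul_assoc]
      _ = 0 := by simp [h]
  refine ⟨(mem_so_iff _).2 ?_, h2, le_min ?_ (rank_le_of_sq_eq_zero h2)⟩
  · rw [Matrix.mul_assoc _ (Q m), Q_mul_Q, mul_one, gram_transpose]
  · rw [Matrix.mul_assoc, Matrix.mul_assoc]
    refine (rank_mul_le_left _ _).trans ((rank_le_card_width _).trans ?_)
    simp [two_mul]

/-! ### Every element of Z comes from the zero fibre -/

/-- The matrix `∑ᵢ (eᵢ pᵢᵀ + fᵢ qᵢᵀ)`. -/
def frameMatrix {ι κ : Type*} {r : ℕ} (e f : Fin r → ι → ℂ) (p q : Fin r → κ → ℂ) :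
    Matrix ι κ ℂ :=
  ∑ i, (vecMulVec (e i) (p i) + vecMulVec (f i) (q i))

theorem frameMatrix_mulVec {ι κ : Type*} [Fintype κ] {r : ℕ} (e f : Fin r → ι → ℂ)
    (p q : Fin r → κ → ℂ) (x : κ → ℂ) :
    frameMatrix e f p q *ᵥ x = ∑ i, ((p i ⬝ᵥ x) • e i + (q i ⬝ᵥ x) • f i) := by
  rw [frameMatrix, sum_mulVec]
  simp [add_mulVec, vecMulVec_mulVec]

theorem mul_frameMatrix {ι κ : Type*} [Fintype ι] {r : ℕ} (g : Matrix ι ι ℂ)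
    (e f : Fin r → ι → ℂ) (p q : Fin r → κ → ℂ) :
    g * frameMatrix e f p q = frameMatrix (fun i => g *ᵥ e i) (fun i => g *ᵥ f i) p q := by
  simp [frameMatrix, Matrix.mul_sum, Matrix.mul_add, mul_vecMulVec]

theorem IsSymplecticSystem.gram_frameMatrix {n m r : ℕ} {e f : Fin r → Fin n ⊕ Fin n → ℂ}
    (h : IsSymplecticSystem e f) {B : Matrix (Fin m ⊕ Fin m) (Fin m ⊕ Fin m) ℂ}
    {p q a b : Fin r → Fin m ⊕ Fin m → ℂ} (hB : IsSkewDecomposition B p q a b) :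
    (frameMatrix e f p q)ᵀ * J n * frameMatrix e f p q = B := by
  have key : ∀ x y, x ⬝ᵥ ((frameMatrix e f p q)ᵀ * J n * frameMatrix e f p q) *ᵥ y =
      x ⬝ᵥ B *ᵥ y := by
    intro x y
    have hfe : ∀ i j, ω (f i) (e j) = if i = j then -1 else 0 := by
      intro i j
      rw [ω_swap, h.pair]
      by_cases hij : i = j
      · simp [hij]
      · simp [hij, Ne.symm hij]
    rw [dotProduct_gram_mulVec, frameMatrix_mulVec, frameMatrix_mulVec, hB.mulVec_eq,
      dotProduct_sum]
    simp only [map_sum, LinearMap.sum_apply, map_add, LinearMap.add_apply, map_smul,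
      LinearMap.smul_apply, h.left, h.right, h.pair, hfe, smul_eq_mul, dotProduct_sub,
      dotProduct_smul]
    refine Finset.sum_congr rfl fun i _ => ?_
    simp [dotProduct_comm x]
    ring
  ext i j
  simpa using key (Pi.single i 1) (Pi.single j 1)

/-- The rows $p_i=-b_i^tB$ and $q_i=a_i^tB$ lie in the row space of $B$. Exhibiting $B$ as a right
factor lets $A^2=0$ be used for $B=AQ$. -/
theorem IsSkewDecomposition.frameMatrix_eq_mul {ι κ : Type*} [Fintype κ] {r : ℕ}
    {B : Matrix κ κ ℂ} {p q a b : Fin r → κ → ℂ} (hB : IsSkewDecomposition B p q a b)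
    (hBt : Bᵀ = -B) (e f : Fin r → ι → ℂ) :
    frameMatrix e f p q = frameMatrix (-e) f b a * B := by
  have hvec : ∀ x, x ᵥ* B = -(B *ᵥ x) := by
    intro x
    rw [← mulVec_transpose, hBt, neg_mulVec]
  have hb : ∀ i, b i ᵥ* B = -p i := by
    intro i
    rw [hvec, hB.mulVec_eq]
    simp [hB.p_b, hB.q_b]
  have ha : ∀ i, a i ᵥ* B = q i := by
    intro i
    rw [hvec, hB.mulVec_eq]
    simp [hB.p_a, hB.q_a]
  simp [frameMatrix, Matrix.sum_mul, Matrix.add_mul, vecMulVec_mul, ha, hb, neg_vecMulVec,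
    vecMulVec_neg]

theorem exists_zeroFibre_gram_eq {n m : ℕ} {A : Matrix (Fin m ⊕ Fin m) (Fin m ⊕ Fin m) ℂ}
    (hA : A ∈ Z n m) : ∃ X : ZeroFibre n m, X.1ᵀ * J n * X.1 * Q m = A := by
  obtain ⟨hso, hsq, hrank⟩ := hA
  rw [mem_so_iff] at hso
  obtain ⟨r, p, q, a, b, h⟩ := exists_isSkewDecomposition _ hso
  -- From $2r\le\operatorname{rk}(AQ)\le\operatorname{rk}A\le 2n$; this leaves room for a symplectic
  -- system of length $r$.
  have hr : r ≤ n := by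
    have h1 := h.two_mul_le_rank.trans (rank_mul_le_left A (Q m))
    have h2 := hrank.trans (min_le_left _ _)
    omega
  have hs := isSymplecticSystem_single hr
  refine ⟨⟨frameMatrix (fun i : Fin r => Pi.single (Sum.inl (Fin.castLE hr i)) 1)
      (fun i => Pi.single (Sum.inr (Fin.castLE hr i)) 1) p q, ?_⟩, ?_⟩
  · rw [momentMap_eq_zero_iff, h.frameMatrix_eq_mul hso, transpose_mul, hso]
    generalize frameMatrix _ _ b a = N
    calc N * (A * Q m) * Q m * (-(A * Q m) * Nᵀ)
        = -(N * (A * (Q m * Q m) * A * Q m * Nᵀ)) := by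
          simp only [Matrix.mul_assoc, Matrix.mul_neg, Matrix.neg_mul]
      _ = 0 := by
          rw [Q_mul_Q, Matrix.mul_one, ← sq, hsq]; simp
  · rw [hs.gram_frameMatrix h, Matrix.mul_assoc, Q_mul_Q, Matrix.mul_one]

/-! ### Invariants, degenerations and equal Gram matrices -/

/-- Evaluation of polynomials at a point of `V`. -/
noncomputable def evalMat {n m : ℕ} (X : Mat n m ℂ) : CoordRing n m →ₐ[ℂ] ℂ :=
  aeval fun p => X p.1 p.2

theorem act_X {n m : ℕ} (g : Sp n) (p : (Fin n ⊕ Fin n) × (Fin m ⊕ Fin m)) :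
    act m g (MvPolynomial.X p) = ∑ k, C (g.1 p.1 k) * MvPolynomial.X (k, p.2) := by
  rw [act, aeval_X, mul_apply]
  rfl

theorem evalMat_act {n m : ℕ} (g : Sp n) (X : Mat n m ℂ) (F : CoordRing n m) :
    evalMat X (act m g F) = evalMat (g.1 * X) F := by
  have : (evalMat X).comp (act m g) = evalMat (g.1 * X) := by
    ext p
    simp [act_X, evalMat, mul_apply]
  exact DFunLike.congr_fun this F

/-- Precomposition is a right action, hence the reversed order. -/
theorem act_mul {n m : ℕ} (g h : Sp n) (F : CoordRing n m) :
    act m (g * h) F = act m h (act m g F) := by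
  have : act m (g * h) = (act m h).comp (act m g) := by
    ext1 p
    rw [AlgHom.comp_apply, act_X, act_X, map_sum]
    simp only [map_mul, act_X]
    have : ∀ c, act m h (C c) = C c := fun c => (act m h).commutes c
    simp only [this, Finset.mul_sum, Submonoid.coe_mul, mul_apply, map_sum, map_mul,
      Finset.sum_mul]
    rw [Finset.sum_comm]
    simp only [mul_assoc]
  exact DFunLike.congr_fun this F

theorem act_one {n m : ℕ} (F : CoordRing n m) : act m (1 : Sp n) F = F := by
  have : act m (1 : Sp n) = AlgHom.id ℂ _ := by
    ext1 p
    rw [act_X]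
    simp [Matrix.one_apply]
  exact DFunLike.congr_fun this F

theorem evalAt_mk {n m : ℕ} (X : ZeroFibre n m) (F : CoordRing n m) :
    evalAt X (Ideal.Quotient.mk _ F) = evalMat X.1 F := rfl

theorem actQuot_mk {n m : ℕ} (g : Sp n) (F : CoordRing n m) :
    actQuot m g (Ideal.Quotient.mk _ F) = Ideal.Quotient.mk _ (act m g F) := rfl

theorem mem_invariants {n m : ℕ} {f : ZeroFibreRing n m} :
    f ∈ invariants n m ↔ ∀ g : Sp n, actQuot m g f = f := by
  simp [invariants, Algebra.mem_iInf, AlgHom.mem_equalizer]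

/-- The condition $XQX^t=0$ is stable under every matrix, invertible or not; this keeps the limits
of degenerations in the zero fibre. -/
theorem mul_mem_zeroFibre {n m : ℕ} (g : Matrix (Fin n ⊕ Fin n) (Fin n ⊕ Fin n) ℂ)
    (X : ZeroFibre n m) : momentMap (g * X.1 : Mat n m ℂ) = 0 := by
  have h := (momentMap_eq_zero_iff X.1).1 X.2
  rw [momentMap_eq_zero_iff]
  calc g * X.1 * Q m * (g * X.1)ᵀ = g * (X.1 * Q m * X.1ᵀ) * gᵀ := by
        simp only [transpose_mul, Matrix.mul_assoc]
    _ = 0 := by simp [h]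

/-- Two points of `μ⁻¹(0)` have the same invariants if all invariants agree at them. -/
def SameInvariants {n m : ℕ} (X Y : ZeroFibre n m) : Prop :=
  ∀ f ∈ invariants n m, evalAt X f = evalAt Y f

theorem sameInvariants_of_mul_eq {n m : ℕ} {X Y : ZeroFibre n m} (g : Sp n)
    (h : g.1 * X.1 = Y.1) : SameInvariants X Y := by
  intro f hf
  obtain ⟨F, rfl⟩ := Ideal.Quotient.mk_surjective f
  have := congrArg (evalAt X) (mem_invariants.1 hf g)
  rw [actQuot_mk, evalAt_mk, evalMat_act, evalAt_mk] at this
  rw [evalAt_mk, evalAt_mk, ← h, this]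

/-- Algebraic passage to the limit $t\to0$: a one-variable polynomial constant off zero is constant.
-/
theorem evalMat_eq_of_line {n m : ℕ} (F : CoordRing n m) (Y U : Mat n m ℂ) (c : ℂ)
    (h : ∀ t : ℂ, t ≠ 0 → evalMat (Y + t • U) F = c) : evalMat Y F = c := by
  let φ : CoordRing n m →ₐ[ℂ] Polynomial ℂ :=
    aeval fun p => Polynomial.C (Y p.1 p.2) + Polynomial.X * Polynomial.C (U p.1 p.2)
  have hφ : ∀ t, Polynomial.eval t (φ F) = evalMat (Y + t • U) F := by
    intro t
    have : (Polynomial.aeval t).comp φ = evalMat (Y + t • U) := by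
      ext p
      simp [φ, evalMat, mul_comm t]
    exact DFunLike.congr_fun this F
  have hc : φ F = Polynomial.C c := by
    refine Polynomial.eq_of_infinite_eval_eq _ _ ?_
    refine (Set.finite_singleton (0 : ℂ)).infinite_compl.mono fun t ht => ?_
    rw [Set.mem_ofPred_eq, hφ, Polynomial.eval_C, h t ht]
  have := hφ 0
  rw [hc, Polynomial.eval_C, zero_smul, add_zero] at this
  exact this.symm

/-- For `ω(w, u) = 1`, the matrix scaling `u` by `t` and `w` by `t⁻¹` and fixing the vectors
orthogonal to both. -/
noncomputable def hyperbolicScaling {n : ℕ} (u w : Fin n ⊕ Fin n → ℂ) (t : ℂ) :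
    Matrix (Fin n ⊕ Fin n) (Fin n ⊕ Fin n) ℂ :=
  1 + (t - 1) • vecMulVec u (w ᵥ* J n) + (1 - t⁻¹) • vecMulVec w (u ᵥ* J n)

theorem hyperbolicScaling_mulVec {n : ℕ} (u w x : Fin n ⊕ Fin n → ℂ) (t : ℂ) :
    hyperbolicScaling u w t *ᵥ x =
      x + ((t - 1) * ω w x) • u + ((1 - t⁻¹) * ω u x) • w := by
  simp only [hyperbolicScaling, add_mulVec, one_mulVec, smul_mulVec, vecMulVec_mulVec, ω_apply,
    dotProduct_mulVec, mul_smul, op_smul_eq_smul]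

theorem hyperbolicScaling_mem {n : ℕ} {u w : Fin n ⊕ Fin n → ℂ} (h : ω w u = 1) {t : ℂ}
    (ht : t ≠ 0) : hyperbolicScaling u w t ∈ Sp n := by
  rw [mem_Sp_iff_ω]
  intro x y
  have huw : ω u w = -1 := by rw [ω_swap, h]
  simp only [hyperbolicScaling_mulVec, map_add, map_smul, LinearMap.add_apply,
    LinearMap.smul_apply, smul_eq_mul, ω_self, ω_swap u x, ω_swap w x, h, huw]
  field_simp
  ring

theorem gram_ext {n m : ℕ} {X Y : Mat n m ℂ}
    (h : ∀ x y, ω (X *ᵥ x) (X *ᵥ y) = ω (Y *ᵥ x) (Y *ᵥ y)) : Xᵀ * J n * X = Yᵀ * J n * Y := by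
  ext i j
  have := h (Pi.single i 1) (Pi.single j 1)
  rw [← dotProduct_gram_mulVec, ← dotProduct_gram_mulVec] at this
  simpa using this

/-- A point of `μ⁻¹(0)` with degenerate column space degenerates to a point of smaller rank. -/
theorem exists_sameInvariants_rank_lt {n m : ℕ} (X : ZeroFibre n m) {a : Fin m ⊕ Fin m → ℂ}
    (ha : (X.1ᵀ * J n * X.1) *ᵥ a = 0) (hXa : X.1 *ᵥ a ≠ 0) :
    ∃ Y : ZeroFibre n m, SameInvariants X Y ∧ Y.1ᵀ * J n * Y.1 = X.1ᵀ * J n * X.1 ∧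
      Y.1.rank < X.1.rank := by
  obtain ⟨w, hw⟩ := exists_ω_eq_one hXa
  set u := X.1 *ᵥ a with hu
  have hxu : ∀ x, ω (X.1 *ᵥ x) u = 0 := by
    intro x
    rw [hu, ← dotProduct_gram_mulVec, ha, dotProduct_zero]
  have hux : ∀ x, ω u (X.1 *ᵥ x) = 0 := fun x => by rw [ω_swap, hxu, neg_zero]
  -- On vectors orthogonal to $u$, this is the limit at $t=0$ of `hyperbolicScaling u w t`. The
  -- columns of $X$ are orthogonal to $u$, so the term with $t^{-1}$ does not contribute.
  let K : Matrix (Fin n ⊕ Fin n) (Fin n ⊕ Fin n) ℂ := 1 - vecMulVec u (w ᵥ* J n)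
  have hK : ∀ x, K *ᵥ x = x - ω w x • u := by
    intro x
    simp [K, sub_mulVec, vecMulVec_mulVec, ω_apply, dotProduct_mulVec]
  have hY : ∀ x, (K * X.1) *ᵥ x = X.1 *ᵥ x - ω w (X.1 *ᵥ x) • u := by
    intro x
    rw [← mulVec_mulVec, hK]
  refine ⟨⟨K * X.1, mul_mem_zeroFibre K X⟩, ?_, ?_, ?_⟩
  · intro f hf
    obtain ⟨F, rfl⟩ := Ideal.Quotient.mk_surjective f
    rw [evalAt_mk, evalAt_mk]
    refine (evalMat_eq_of_line F _ (vecMulVec u (w ᵥ* J n) * X.1) _ fun t ht => ?_).symm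
    have h1 := sameInvariants_of_mul_eq (X := X) (Y := ⟨_, mul_mem_zeroFibre _ X⟩)
      ⟨_, hyperbolicScaling_mem hw ht⟩ rfl _ hf
    rw [evalAt_mk, evalAt_mk] at h1
    rw [h1]
    congr 1
    refine congrArg evalMat (Matrix.toLin'.injective (LinearMap.ext fun x => ?_))
    simp only [toLin'_apply]
    rw [add_mulVec, hY, smul_mulVec, ← mulVec_mulVec, ← mulVec_mulVec, hyperbolicScaling_mulVec,
      hux, vecMulVec_mulVec, ← dotProduct_mulVec, ← ω_apply, op_smul_eq_smul, mul_zero, zero_smul,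
      add_zero]
    module
  · refine gram_ext fun x y => ?_
    simp [hY, hxu, hux, ω_self]
  -- The vector $u$ is in the range of $X$ but not in that of $KX$, on which $\omega(w,\cdot)$
  -- vanishes.
  · refine Submodule.finrank_lt_finrank_of_lt (lt_of_le_of_ne ?_ fun heq => ?_)
    · rintro _ ⟨x, rfl⟩
      refine ⟨x - ω w (X.1 *ᵥ x) • a, ?_⟩
      simp [hY, mulVec_sub, mulVec_smul, hu]
    · have : u ∈ LinearMap.range (K * X.1).mulVecLin := heq ▸ ⟨a, rfl⟩
      obtain ⟨x, hx⟩ := this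
      rw [mulVecLin_apply, hY] at hx
      have := congrArg (ω w) hx
      rw [map_sub, map_smul, hw] at this
      simp at this

/-- Degenerations are repeated until the kernel of the point contains that of its Gram matrix; the
rank drops each time. -/
theorem exists_sameInvariants_ker_le {n m : ℕ} (X : ZeroFibre n m) :
    ∃ Y : ZeroFibre n m, SameInvariants X Y ∧ Y.1ᵀ * J n * Y.1 = X.1ᵀ * J n * X.1 ∧
      ∀ a, (X.1ᵀ * J n * X.1) *ᵥ a = 0 → Y.1 *ᵥ a = 0 := by
  by_cases h : ∀ a, (X.1ᵀ * J n * X.1) *ᵥ a = 0 → X.1 *ᵥ a = 0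
  · exact ⟨X, fun _ _ => rfl, rfl, h⟩
  push Not at h
  obtain ⟨a, ha, hXa⟩ := h
  obtain ⟨Y, hXY, hgram, hrank⟩ := exists_sameInvariants_rank_lt X ha hXa
  obtain ⟨W, hYW, hgram', hW⟩ := exists_sameInvariants_ker_le Y
  rw [hgram] at hgram' hW
  exact ⟨W, fun f hf => (hXY f hf).trans (hYW f hf), hgram', hW⟩
termination_by X.1.rank

/-- Modulo the kernel of $B$, each $x$ equals $\sum_i((p_i\cdot x)a_i+(q_i\cdot x)b_i)$, so $X$ is
determined by its values on $a_i,b_i$. -/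
theorem IsSkewDecomposition.eq_frameMatrix {n m r : ℕ}
    {B : Matrix (Fin m ⊕ Fin m) (Fin m ⊕ Fin m) ℂ} {p q a b : Fin r → Fin m ⊕ Fin m → ℂ}
    (hB : IsSkewDecomposition B p q a b) {X : Mat n m ℂ} (hX : ∀ x, B *ᵥ x = 0 → X *ᵥ x = 0) :
    X = frameMatrix (fun i => X *ᵥ a i) (fun i => X *ᵥ b i) p q := by
  refine Matrix.toLin'.injective (LinearMap.ext fun x => ?_)
  simp only [toLin'_apply]
  have hx : B *ᵥ (x - ∑ i, ((p i ⬝ᵥ x) • a i + (q i ⬝ᵥ x) • b i)) = 0 := by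
    have ha : ∀ i, B *ᵥ a i = -q i := by
      intro i; rw [hB.mulVec_eq]; simp [hB.p_a, hB.q_a]
    have hb : ∀ i, B *ᵥ b i = p i := by
      intro i; rw [hB.mulVec_eq]; simp [hB.p_b, hB.q_b]
    rw [mulVec_sub, mulVec_sum, hB.mulVec_eq x]
    simp only [mulVec_add, mulVec_smul, ha, hb]
    rw [sub_eq_zero]
    refine Finset.sum_congr rfl fun i _ => ?_
    module
  have := hX _ hx
  rw [mulVec_sub, mulVec_sum, sub_eq_zero] at this
  rw [this, frameMatrix_mulVec]
  simp only [mulVec_add, mulVec_smul]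

theorem IsSkewDecomposition.isSymplecticSystem {n m r : ℕ} {X : Mat n m ℂ}
    {p q a b : Fin r → Fin m ⊕ Fin m → ℂ}
    (hB : IsSkewDecomposition (Xᵀ * J n * X) p q a b) :
    IsSymplecticSystem (fun i => X *ᵥ a i) (fun i => X *ᵥ b i) := by
  constructor <;> intro i j <;> rw [← dotProduct_gram_mulVec]
  · rw [hB.a_dotProduct, hB.q_a]
  · rw [hB.b_dotProduct, hB.p_b, neg_zero]
  · rw [hB.a_dotProduct, hB.q_b]

/-- After degeneration, both points are frames with the same rows $p,q$ along two symplectic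
systems, which Witt's theorem makes conjugate. -/
theorem sameInvariants_of_gram_eq {n m : ℕ} (X Y : ZeroFibre n m)
    (h : X.1ᵀ * J n * X.1 = Y.1ᵀ * J n * Y.1) : SameInvariants X Y := by
  obtain ⟨X', hXX', hX', hkX⟩ := exists_sameInvariants_ker_le X
  obtain ⟨Y', hYY', hY', hkY⟩ := exists_sameInvariants_ker_le Y
  rw [← h] at hY' hkY
  obtain ⟨r, p, q, a, b, hB⟩ := exists_isSkewDecomposition _ (gram_transpose X.1)
  have hBX := hB
  have hBY := hB
  rw [← hX'] at hBX
  rw [← hY'] at hBY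
  obtain ⟨g, -, hg⟩ := hBX.isSymplecticSystem.exists_transvectionGroup hBY.isSymplecticSystem
  have hmul : g.1 * X'.1 = Y'.1 := by
    rw [hB.eq_frameMatrix hkX, hB.eq_frameMatrix hkY, mul_frameMatrix]
    congr 1
    · exact funext fun i => (hg i).1
    · exact funext fun i => (hg i).2
  intro f hf
  rw [hXX' f hf, hYY' f hf, sameInvariants_of_mul_eq g hmul f hf]

/-! ### Gram entries as invariants, and the fibres of the quotient map -/

/-- The entries of `Xᵀ J X` as polynomials on `V`. -/
noncomputable def gramPoly (n m : ℕ) :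
    Matrix (Fin m ⊕ Fin m) (Fin m ⊕ Fin m) (CoordRing n m) :=
  (mvPolynomialX (Fin n ⊕ Fin n) (Fin m ⊕ Fin m) ℂ)ᵀ *
    (J n).map (algebraMap ℂ (CoordRing n m)) * mvPolynomialX (Fin n ⊕ Fin n) (Fin m ⊕ Fin m) ℂ

theorem map_gramPoly {n m : ℕ} {R : Type*} [CommRing R] [Algebra ℂ R] (φ : CoordRing n m →ₐ[ℂ] R) :
    (gramPoly n m).map φ = ((mvPolynomialX (Fin n ⊕ Fin n) (Fin m ⊕ Fin m) ℂ).map φ)ᵀ *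
      (J n).map (algebraMap ℂ R) * (mvPolynomialX (Fin n ⊕ Fin n) (Fin m ⊕ Fin m) ℂ).map φ := by
  have h : ((J n).map (algebraMap ℂ (CoordRing n m))).map φ = (J n).map (algebraMap ℂ R) := by
    ext; simp
  rw [gramPoly, Matrix.map_mul, Matrix.map_mul, h, transpose_map]

theorem evalMat_gramPoly {n m : ℕ} (X : Mat n m ℂ) (i j) :
    evalMat X (gramPoly n m i j) = (Xᵀ * J n * X) i j := by
  have h := map_gramPoly (evalMat X)
  have hX : (mvPolynomialX (Fin n ⊕ Fin n) (Fin m ⊕ Fin m) ℂ).map (evalMat X) = X := by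
    ext
    simp [evalMat]
  rw [hX] at h
  exact congrFun (congrFun h i) j

theorem act_gramPoly {n m : ℕ} (g : Sp n) (i j) :
    act m g (gramPoly n m i j) = gramPoly n m i j := by
  have h := map_gramPoly (act m g)
  have hX : (mvPolynomialX (Fin n ⊕ Fin n) (Fin m ⊕ Fin m) ℂ).map (act m g) =
      g.1.map (algebraMap ℂ (CoordRing n m)) *
        mvPolynomialX (Fin n ⊕ Fin n) (Fin m ⊕ Fin m) ℂ := by
    ext i j : 2
    rw [Matrix.map_apply, mvPolynomialX_apply, act, aeval_X]
  have hg := congrArg (fun M => M.map (algebraMap ℂ (CoordRing n m))) (mem_Sp_iff.1 g.2)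
  simp only [Matrix.map_mul, transpose_map] at hg
  have h' : (gramPoly n m).map (act m g) = gramPoly n m := by
    rw [h, hX, transpose_mul, gramPoly]
    conv_rhs => rw [← hg]
    simp only [Matrix.mul_assoc]
  exact congrFun (congrFun h' i) j

theorem gramPoly_mem_invariants {n m : ℕ} (i j) :
    Ideal.Quotient.mk (momentIdeal n m) (gramPoly n m i j) ∈ invariants n m :=
  mem_invariants.2 fun g => by rw [actQuot_mk, act_gramPoly]

theorem quotientMap_eq_iff {n m : ℕ} (X Y : ZeroFibre n m) :
    quotientMap X = quotientMap Y ↔ X.1ᵀ * J n * X.1 = Y.1ᵀ * J n * Y.1 := by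
  constructor
  · intro h
    have hk : RingHom.ker ((evalAt X).comp (invariants n m).val) =
      RingHom.ker ((evalAt Y).comp (invariants n m).val) := congrArg MaximalSpectrum.asIdeal h
    ext i j
    let f : invariants n m := ⟨_, gramPoly_mem_invariants (n := n) (m := m) i j⟩
    let c : ℂ := evalAt X f.1
    -- Subtracting its value at $X$ puts a Gram invariant into the maximal ideal of $X$, hence into
    -- that of $Y$.
    have hX : f - algebraMap ℂ _ c ∈ RingHom.ker ((evalAt X).comp (invariants n m).val) := by
      rw [RingHom.mem_ker, map_sub, AlgHom.commutes]
      exact sub_self c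
    rw [hk, RingHom.mem_ker, map_sub, AlgHom.commutes, sub_eq_zero] at hX
    have hX' : evalAt Y f.1 = evalAt X f.1 := hX
    rw [evalAt_mk, evalAt_mk, evalMat_gramPoly, evalMat_gramPoly] at hX'
    exact hX'.symm
  · intro h
    refine MaximalSpectrum.ext (Ideal.ext fun f => ?_)
    change evalAt X f.1 = 0 ↔ evalAt Y f.1 = 0
    rw [sameInvariants_of_gram_eq X Y h f.1 f.2]

/-! ### Families of operators closed under negative adjoints -/

section Adjoint

variable {H ι : Type*} [NormedAddCommGroup H] [InnerProductSpace ℂ H] {D : ι → H →ₗ[ℂ] H}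

/-- Substitute for the Reynolds projection. If $t\in W$ is orthogonal to all $D_aW$, then $\langle
D_at,D_at\rangle=-\langle t,D_bD_at\rangle=0$, so the component of $r$ orthogonal to the images is
killed by every $D_a$. -/
theorem exists_sub_mem_iSup_range (hD : ∀ a, ∃ b, ∀ x y, inner ℂ (D a x) y = -inner ℂ x (D b y))
    (W : Submodule ℂ H) [FiniteDimensional ℂ W] (hW : ∀ a, ∀ x ∈ W, D a x ∈ W) {r : H}
    (hr : r ∈ W) : ∃ r', (∀ a, D a r' = 0) ∧ r - r' ∈ ⨆ a, LinearMap.range (D a) := by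
  let N : Submodule ℂ H := ⨆ a, W.map (D a)
  have hNW : N ≤ W := iSup_le fun a => by
    rintro _ ⟨x, hx, rfl⟩
    exact hW a x hx
  have : FiniteDimensional ℂ N := Submodule.finiteDimensional_of_le hNW
  obtain ⟨s, hs, t, ht, rfl⟩ := N.exists_add_mem_mem_orthogonal r
  have htW : t ∈ W := by simpa using W.sub_mem hr (hNW hs)
  refine ⟨t, fun a => ?_, ?_⟩
  · obtain ⟨b, hb⟩ := hD a
    rw [← inner_self_eq_zero (𝕜 := ℂ), hb, neg_eq_zero]
    refine Submodule.inner_left_of_mem_orthogonal ?_ ht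
    exact Submodule.mem_iSup_of_mem b ⟨_, hW a t htW, rfl⟩
  · rw [add_sub_cancel_right]
    exact iSup_mono (fun a => LinearMap.map_le_range) hs

/-- Modulo the stable space $U$, a vector killed by all $D_a$ and lying in the sum of their images
is zero. Its component orthogonal to $U$ is killed by all $D_a$, hence is orthogonal to all images
as well. -/
theorem mem_of_mem_sup_iSup_range
    (hD : ∀ a, ∃ b, ∀ x y, inner ℂ (D a x) y = -inner ℂ x (D b y))
    (U : Submodule ℂ H) [FiniteDimensional ℂ U] (hU : ∀ a, ∀ x ∈ U, D a x ∈ U) {f : H}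
    (hf : f ∈ U ⊔ ⨆ a, LinearMap.range (D a)) (hDf : ∀ a, D a f ∈ U) : f ∈ U := by
  obtain ⟨s, hs, t, ht, rfl⟩ := U.exists_add_mem_mem_orthogonal f
  have hDt : ∀ a, D a t = 0 := by
    intro a
    have h1 : D a t ∈ U := by simpa using U.sub_mem (hDf a) (hU a s hs)
    obtain ⟨b, hb⟩ := hD a
    rw [← inner_self_eq_zero (𝕜 := ℂ), hb, neg_eq_zero]
    exact Submodule.inner_left_of_mem_orthogonal (hU b _ h1) ht
  have htN : t ∈ (⨆ a, LinearMap.range (D a))ᗮ := by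
    have h : ⨆ a, LinearMap.range (D a) ≤ (ℂ ∙ t)ᗮ := iSup_le fun a => by
      rintro _ ⟨y, rfl⟩
      obtain ⟨b, hb⟩ := hD a
      rw [Submodule.mem_orthogonal_singleton_iff_inner_left, hb, hDt, inner_zero_right, neg_zero]
    exact fun u hu => Submodule.mem_orthogonal_singleton_iff_inner_left.1 (h hu)
  have ht0 : t = 0 := by
    have h1 : t ∈ U ⊔ ⨆ a, LinearMap.range (D a) := by
      simpa using Submodule.sub_mem _ hf (Submodule.mem_sup_left hs)
    have h2 : t ∈ (U ⊔ ⨆ a, LinearMap.range (D a))ᗮ := by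
      rw [← Submodule.inf_orthogonal]
      exact ⟨ht, htN⟩
    rw [← inner_self_eq_zero (𝕜 := ℂ)]
    exact Submodule.inner_right_of_mem_orthogonal h1 h2
  rw [ht0, add_zero]
  exact hs

end Adjoint

section AdjointCore

variable {H ι : Type*} [AddCommGroup H] [Module ℂ H] (c : InnerProductSpace.Core ℂ H)
  {D : ι → H →ₗ[ℂ] H}

theorem exists_sub_mem_iSup_range_of_core
    (hD : ∀ a, ∃ b, ∀ x y, c.inner (D a x) y = -c.inner x (D b y))
    (W : Submodule ℂ H) [FiniteDimensional ℂ W] (hW : ∀ a, ∀ x ∈ W, D a x ∈ W) {r : H}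
    (hr : r ∈ W) : ∃ r', (∀ a, D a r' = 0) ∧ r - r' ∈ ⨆ a, LinearMap.range (D a) := by
  let : NormedAddCommGroup H := c.toNormedAddCommGroup
  let : InnerProductSpace ℂ H := InnerProductSpace.ofCore c.toCore
  exact exists_sub_mem_iSup_range hD W hW hr

theorem mem_of_mem_sup_iSup_range_of_core
    (hD : ∀ a, ∃ b, ∀ x y, c.inner (D a x) y = -c.inner x (D b y))
    (U : Submodule ℂ H) [FiniteDimensional ℂ U] (hU : ∀ a, ∀ x ∈ U, D a x ∈ U) {f : H}
    (hf : f ∈ U ⊔ ⨆ a, LinearMap.range (D a)) (hDf : ∀ a, D a f ∈ U) : f ∈ U := by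
  let : NormedAddCommGroup H := c.toNormedAddCommGroup
  let : InnerProductSpace ℂ H := InnerProductSpace.ofCore c.toCore
  exact mem_of_mem_sup_iSup_range hD U hU hf hDf

end AdjointCore

/-! ### The Fischer inner product -/

section Fischer

variable {σ : Type*} [Fintype σ]

open scoped ComplexConjugate Nat

/-- The product of the factorials of the exponents. -/
def expFactorial (α : σ →₀ ℕ) : ℕ := ∏ i, (α i)!

theorem expFactorial_pos (α : σ →₀ ℕ) : 0 < expFactorial α :=
  Finset.prod_pos fun _ _ => Nat.factorial_pos _

theorem expFactorial_add_single [DecidableEq σ] (α : σ →₀ ℕ) (i : σ) :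
    expFactorial (α + Finsupp.single i 1) = (α i + 1) * expFactorial α := by
  rw [expFactorial, expFactorial, ← Finset.mul_prod_erase _ _ (Finset.mem_univ i),
    ← Finset.mul_prod_erase _ (fun j => (α j)!) (Finset.mem_univ i), ← mul_assoc]
  congr 1
  · simp [Nat.factorial_succ]
  · refine Finset.prod_congr rfl fun j hj => ?_
    simp [(Finset.ne_of_mem_erase hj).symm]

/-- The Fischer inner product `⟨f, g⟩ = ∑ α! conj(f_α) g_α` on polynomials. -/
noncomputable def fischer (f : MvPolynomial σ ℂ) : MvPolynomial σ ℂ →ₗ[ℂ] ℂ :=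
  (basisMonomials σ ℂ).constr ℂ fun α => (expFactorial α : ℂ) * conj (coeff α f)

theorem fischer_monomial (f : MvPolynomial σ ℂ) (α : σ →₀ ℕ) (c : ℂ) :
    fischer f (monomial α c) = expFactorial α * conj (coeff α f) * c := by
  have h : monomial α c = c • basisMonomials σ ℂ α := by simp [smul_monomial]
  rw [h, map_smul, fischer, Module.Basis.constr_basis, smul_eq_mul, mul_comm]

theorem fischer_apply (f g : MvPolynomial σ ℂ) :
    fischer f g = ∑ α ∈ g.support, expFactorial α * conj (coeff α f) * coeff α g := by
  conv_lhs => rw [g.as_sum, map_sum]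
  simp only [fischer_monomial]

theorem fischer_add_left (f f' g : MvPolynomial σ ℂ) :
    fischer (f + f') g = fischer f g + fischer f' g := by
  simp only [fischer_apply, coeff_add, map_add, mul_add, add_mul, Finset.sum_add_distrib]

theorem fischer_smul_left (c : ℂ) (f g : MvPolynomial σ ℂ) :
    fischer (c • f) g = conj c * fischer f g := by
  simp only [fischer_apply, coeff_smul, smul_eq_mul, map_mul, Finset.mul_sum]
  exact Finset.sum_congr rfl fun _ _ => by ring

theorem conj_fischer (f g : MvPolynomial σ ℂ) : conj (fischer g f) = fischer f g := by
  classical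
  have key : ∀ f g : MvPolynomial σ ℂ, fischer f g =
      ∑ α ∈ f.support ∪ g.support, expFactorial α * conj (coeff α f) * coeff α g := by
    intro f g
    rw [fischer_apply]
    refine Finset.sum_subset Finset.subset_union_right fun α _ hα => ?_
    rw [notMem_support_iff.1 hα, mul_zero]
  rw [key, key, map_sum, Finset.union_comm]
  refine Finset.sum_congr rfl fun α _ => ?_
  simp only [map_mul, Complex.conj_conj, map_natCast]
  ring

theorem fischer_self (f : MvPolynomial σ ℂ) :
    fischer f f = ((∑ α ∈ f.support, expFactorial α * ‖coeff α f‖ ^ 2 : ℝ) : ℂ) := by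
  rw [fischer_apply]
  push_cast
  refine Finset.sum_congr rfl fun α _ => ?_
  have h := Complex.conj_mul' (coeff α f)
  rw [mul_assoc, h]

/-- The inner product space structure on polynomials given by `fischer`. -/
noncomputable abbrev fischerCore : InnerProductSpace.Core ℂ (MvPolynomial σ ℂ) where
  inner f g := fischer f g
  conj_inner_symm := conj_fischer
  re_inner_nonneg f := by
    change 0 ≤ (fischer f f).re
    rw [fischer_self, Complex.ofReal_re]
    positivity
  add_left := fischer_add_left
  smul_left f g c := fischer_smul_left c f g
  definite f hf := by
    change fischer f f = 0 at hf
    rw [fischer_self, Complex.ofReal_eq_zero, Finset.sum_eq_zero_iff_of_nonneg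
      fun _ _ => by positivity] at hf
    ext α
    by_contra h
    have h1 := hf α (mem_support_iff.2 h)
    have h2 := expFactorial_pos α
    have h3 : coeff α f ≠ 0 := h
    have : (0 : ℝ) < expFactorial α * ‖coeff α f‖ ^ 2 := by positivity
    exact this.ne' h1

/-- The factorial weights are chosen so that multiplication by a variable is adjoint to
differentiation: $(\alpha+e_i)!=(\alpha_i+1)\,\alpha!$. -/
theorem fischer_X_mul (i : σ) (f g : MvPolynomial σ ℂ) :
    fischer (X i * f) g = fischer f (pderiv i g) := by
  classical
  have : fischer (X i * f) = (fischer f).comp (pderiv i).toLinearMap := by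
    refine (basisMonomials σ ℂ).ext fun α => ?_
    simp only [coe_basisMonomials, LinearMap.comp_apply, Derivation.coeFn_coe, pderiv_monomial,
      fischer_monomial, coeff_X_mul']
    by_cases hi : i ∈ α.support
    · obtain ⟨β, rfl⟩ : ∃ β, α = β + Finsupp.single i 1 :=
        ⟨α - Finsupp.single i 1, by
          rw [tsub_add_cancel_of_le]
          rw [Finsupp.single_le_iff]
          exact Nat.one_le_iff_ne_zero.2 (Finsupp.mem_support_iff.1 hi)⟩
      rw [if_pos hi, add_tsub_cancel_right, expFactorial_add_single]
      simp
      ring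
    · rw [if_neg hi, Finsupp.notMem_support_iff.1 hi]
      simp
  exact DFunLike.congr_fun this g

theorem fischer_pderiv (i : σ) (f g : MvPolynomial σ ℂ) :
    fischer (pderiv i f) g = fischer f (X i * g) := by
  rw [← conj_fischer, ← fischer_X_mul, conj_fischer]

end Fischer

/-! ### Derivations induced by matrices -/

/-- The operators do not raise degree, so polynomials of bounded degree form the finite-dimensional
stable spaces on which orthogonal projection is available. -/
theorem X_mul_pderiv_mem {σ : Type*} (i j : σ) {d : ℕ} {f : MvPolynomial σ ℂ}
    (hf : f ∈ restrictTotalDegree σ ℂ d) : X i * pderiv j f ∈ restrictTotalDegree σ ℂ d := by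
  classical
  rw [mem_restrictTotalDegree, totalDegree, Finset.sup_le_iff] at hf ⊢
  intro α hα
  rw [mem_support_iff, coeff_X_mul'] at hα
  have hi : i ∈ α.support := by
    by_contra h
    simp [h] at hα
  rw [if_pos hi, coeff_pderiv] at hα
  have h := hf _ (mem_support_iff.2 (left_ne_zero_of_mul hα))
  have h1 : (α - Finsupp.single i 1) + Finsupp.single i 1 = α := by
    rw [tsub_add_cancel_of_le]
    rw [Finsupp.single_le_iff]
    exact Nat.one_le_iff_ne_zero.2 (Finsupp.mem_support_iff.1 hi)
  rw [← h1]
  rw [Finsupp.sum_add_index' (by simp) (by simp)] at h ⊢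
  simpa using h

theorem derivation_sum_apply {R A M τ : Type*} [CommSemiring R] [CommSemiring A] [AddCommMonoid M]
    [Algebra R A] [Module A M] [Module R M] (s : Finset τ) (E : τ → Derivation R A M) (f : A) :
    (∑ a ∈ s, E a) f = ∑ a ∈ s, E a f :=
  map_sum ((Pi.evalAddMonoidHom _ f).comp Derivation.coeFnAddMonoidHom) E s

section LieDer

variable {ι κ : Type*} [Fintype ι]

/-- The entries of `A X` for the matrix `X` of variables. -/
noncomputable def linForm (A : Matrix ι ι ℂ) (p : ι × κ) : MvPolynomial (ι × κ) ℂ :=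
  ∑ k, C (A p.1 k) * X (k, p.2)

/-- The derivation of the polynomial functions of a matrix `X` that maps `X` to `A X`. -/
noncomputable def lieDer (κ : Type*) (A : Matrix ι ι ℂ) :
    Derivation ℂ (MvPolynomial (ι × κ) ℂ) (MvPolynomial (ι × κ) ℂ) :=
  mkDerivation ℂ (linForm A)

theorem lieDer_X (A : Matrix ι ι ℂ) (p : ι × κ) : lieDer κ A (X p) = linForm A p :=
  mkDerivation_X _ _ _

theorem lieDer_C_mul (A : Matrix ι ι ℂ) (c : ℂ) (f : MvPolynomial (ι × κ) ℂ) :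
    lieDer κ A (C c * f) = C c * lieDer κ A f := by
  rw [Derivation.leibniz, derivation_C, smul_zero, add_zero, smul_eq_mul]

theorem lieDer_linForm (A B : Matrix ι ι ℂ) (p : ι × κ) :
    lieDer κ A (linForm B p) = linForm (B * A) p := by
  rw [linForm, map_sum]
  simp only [lieDer_C_mul, lieDer_X, linForm, Finset.mul_sum, mul_apply, map_sum, Finset.sum_mul,
    map_mul]
  rw [Finset.sum_comm]
  simp only [mul_assoc]

variable [Fintype κ]

theorem lieDer_apply (A : Matrix ι ι ℂ) (f : MvPolynomial (ι × κ) ℂ) :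
    lieDer κ A f = ∑ j, ∑ i, ∑ k, A i k • (X (k, j) * pderiv (i, j) f) := by
  classical
  have : lieDer κ A =
      ∑ j, ∑ i, ∑ k, A i k • (X (k, j) : MvPolynomial (ι × κ) ℂ) • pderiv (i, j) := by
    refine derivation_ext fun p => ?_
    rw [lieDer_X, linForm]
    simp only [derivation_sum_apply, Derivation.smul_apply, pderiv_X, smul_eq_mul]
    symm
    rw [Finset.sum_eq_single p.2, Finset.sum_eq_single p.1]
    · simp [smul_eq_C_mul]
    · intro i _ hi
      refine Finset.sum_eq_zero fun k _ => ?_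
      rw [Pi.single_eq_of_ne, mul_zero, smul_zero]
      exact fun h => hi (congrArg Prod.fst h).symm
    · simp
    · intro j _ hj
      refine Finset.sum_eq_zero fun i _ => Finset.sum_eq_zero fun k _ => ?_
      rw [Pi.single_eq_of_ne, mul_zero, smul_zero]
      exact fun h => hj (congrArg Prod.snd h).symm
    · simp
  rw [this]
  simp only [derivation_sum_apply, Derivation.smul_apply, smul_eq_mul]

theorem lieDer_neg (A : Matrix ι ι ℂ) (f : MvPolynomial (ι × κ) ℂ) :
    lieDer κ (-A) f = -lieDer κ A f := by
  simp [lieDer_apply]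

/-- The derivation is a combination of operators $X_{kj}\partial_{ij}$, whose adjoints are
$X_{ij}\partial_{kj}$. -/
theorem fischer_lieDer (A : Matrix ι ι ℂ) (f g : MvPolynomial (ι × κ) ℂ) :
    fischer (lieDer κ A f) g = fischer f (lieDer κ Aᴴ g) := by
  let φ : MvPolynomial (ι × κ) ℂ →+ ℂ := AddMonoidHom.mk' (fun h => fischer h g)
    fun a b => fischer_add_left a b g
  have hφ : ∀ h, fischer h g = φ h := fun _ => rfl
  rw [lieDer_apply, lieDer_apply, hφ]
  simp only [map_sum]
  refine Finset.sum_congr rfl fun j _ => ?_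
  rw [Finset.sum_comm]
  refine Finset.sum_congr rfl fun k _ => Finset.sum_congr rfl fun i _ => ?_
  rw [← hφ, fischer_smul_left, fischer_X_mul, fischer_pderiv, map_smul]
  simp [conjTranspose_apply]

theorem lieDer_mem_restrictTotalDegree {d : ℕ} (A : Matrix ι ι ℂ) {f : MvPolynomial (ι × κ) ℂ}
    (hf : f ∈ restrictTotalDegree _ ℂ d) : lieDer κ A f ∈ restrictTotalDegree _ ℂ d := by
  rw [lieDer_apply]
  exact Submodule.sum_mem _ fun j _ => Submodule.sum_mem _ fun i _ => Submodule.sum_mem _ fun k _ =>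
    Submodule.smul_mem _ _ (X_mul_pderiv_mem _ _ hf)

end LieDer

/-! ### Square-zero elements and the two projection statements -/

/-- The square-zero element `x ↦ ω(v, x) v` of `sp_{2n}`. -/
def nilMatrix {n : ℕ} (v : Fin n ⊕ Fin n → ℂ) : Matrix (Fin n ⊕ Fin n) (Fin n ⊕ Fin n) ℂ :=
  vecMulVec v (v ᵥ* J n)

theorem nilMatrix_mul_self {n : ℕ} (v : Fin n ⊕ Fin n → ℂ) : nilMatrix v * nilMatrix v = 0 := by
  have h : (v ᵥ* J n) ⬝ᵥ v = 0 := by rw [← dotProduct_mulVec, ← ω_apply, ω_self]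
  rw [nilMatrix, vecMulVec_mul_vecMulVec, h]
  simp

/-- Closure of the family under $A\mapsto-A^{H}$, which with `fischer_lieDer` supplies the adjoint
hypothesis for the derivations. -/
theorem conjTranspose_nilMatrix {n : ℕ} (v : Fin n ⊕ Fin n → ℂ) :
    (nilMatrix v)ᴴ = -nilMatrix (J n *ᵥ star v) := by
  have hJ : (J n)ᴴ = -J n := by
    rw [J, fromBlocks_conjTranspose, fromBlocks_neg]
    simp
  have h1 : (J n *ᵥ star v) ᵥ* J n = star v := by
    rw [← mulVec_transpose, J_transpose, mulVec_mulVec, neg_mul, J_mul_J, neg_neg, one_mulVec]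
  have h2 : star (v ᵥ* J n) = -(J n *ᵥ star v) := by
    rw [star_vecMul, hJ, neg_mulVec]
  rw [nilMatrix, nilMatrix, h1, conjTranspose_vecMulVec, h2, neg_vecMulVec]

theorem fischer_lieDer_nilMatrix {n m : ℕ} (v : Fin n ⊕ Fin n → ℂ) :
    ∃ w, ∀ f g : CoordRing n m, fischer (lieDer (Fin m ⊕ Fin m) (nilMatrix v) f) g =
      -fischer f (lieDer (Fin m ⊕ Fin m) (nilMatrix w) g) :=
  ⟨J n *ᵥ star v, fun f g => by
    rw [fischer_lieDer, conjTranspose_nilMatrix, lieDer_neg, map_neg]⟩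

/-- The span of the images of the derivations of `ℂ[V]` that come from `sp_{2n}`. -/
noncomputable def lieImage (n m : ℕ) : Submodule ℂ (CoordRing n m) :=
  ⨆ v : Fin n ⊕ Fin n → ℂ, LinearMap.range (lieDer (Fin m ⊕ Fin m) (nilMatrix v)).toLinearMap

theorem exists_lieDer_eq_zero_sub_mem_lieImage {n m : ℕ} (f : CoordRing n m) :
    ∃ f', (∀ v, lieDer (Fin m ⊕ Fin m) (nilMatrix v) f' = 0) ∧ f - f' ∈ lieImage n m := by
  exact exists_sub_mem_iSup_range_of_core fischerCore
    (D := fun v => (lieDer (Fin m ⊕ Fin m) (nilMatrix v)).toLinearMap) fischer_lieDer_nilMatrix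
    (restrictTotalDegree _ ℂ f.totalDegree)
    (fun v f hf => lieDer_mem_restrictTotalDegree _ hf) (r := f)
    ((mem_restrictTotalDegree _ _ _).2 le_rfl)

/-- Applied to the part of $I$ of bounded degree, which is finite-dimensional and stable under the
derivations. -/
theorem mem_of_mem_sup_lieImage {n m : ℕ} (I : Ideal (CoordRing n m))
    (hI : ∀ v, ∀ f ∈ I, lieDer (Fin m ⊕ Fin m) (nilMatrix v) f ∈ I) {f i : CoordRing n m} (hi : i ∈ I)
    (hf : f - i ∈ lieImage n m) (hDf : ∀ v, lieDer (Fin m ⊕ Fin m) (nilMatrix v) f ∈ I) : f ∈ I := by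
  let W := restrictTotalDegree ((Fin n ⊕ Fin n) × (Fin m ⊕ Fin m)) ℂ
    (max f.totalDegree i.totalDegree)
  have hfW : f ∈ W := (mem_restrictTotalDegree _ _ _).2 (le_max_left _ _)
  have hiW : i ∈ W := (mem_restrictTotalDegree _ _ _).2 (le_max_right _ _)
  let U : Submodule ℂ (CoordRing n m) := I.restrictScalars ℂ ⊓ W
  have : FiniteDimensional ℂ W := inferInstanceAs (Module.Finite ℂ (restrictTotalDegree _ _ _))
  have : FiniteDimensional ℂ U := Submodule.finiteDimensional_of_le inf_le_right
  refine (mem_of_mem_sup_iSup_range_of_core fischerCore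
    (D := fun v => (lieDer (Fin m ⊕ Fin m) (nilMatrix v)).toLinearMap) fischer_lieDer_nilMatrix U
    (fun v f hf => ⟨hI v f hf.1, lieDer_mem_restrictTotalDegree _ hf.2⟩) (f := f) ?_
    fun v => ⟨hDf v, lieDer_mem_restrictTotalDegree _ hfW⟩).1
  exact Submodule.mem_sup.2 ⟨i, ⟨hi, hiW⟩, f - i, hf, add_sub_cancel _ _⟩

/-! ### From group action to derivations and back -/

/-- The polynomial family `t ↦ f((1 + tN) X)` for `N = nilMatrix v`. -/
noncomputable def shear {n : ℕ} (m : ℕ) (v : Fin n ⊕ Fin n → ℂ) :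
    CoordRing n m →ₐ[ℂ] Polynomial (CoordRing n m) :=
  aeval fun p => Polynomial.C (X p) + Polynomial.X * Polynomial.C (linForm (nilMatrix v) p)

theorem shear_X {n m : ℕ} (v : Fin n ⊕ Fin n → ℂ) (p : (Fin n ⊕ Fin n) × (Fin m ⊕ Fin m)) :
    shear m v (X p) =
      Polynomial.C (X p) + Polynomial.X * Polynomial.C (linForm (nilMatrix v) p) :=
  aeval_X _ _

theorem eval_shear {n m : ℕ} (v : Fin n ⊕ Fin n → ℂ) (c : ℂ) (f : CoordRing n m) :
    (shear m v f).eval (C c) = act m (transvection c v) f := by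
  have : ((Polynomial.aeval (C c : CoordRing n m)).restrictScalars ℂ).comp (shear m v) =
      act m (transvection c v) := by
    ext1 p
    rw [AlgHom.comp_apply, shear_X, act_X]
    change Polynomial.eval (C c) _ = ∑ k, C (transvectionMatrix c v p.1 k) * X (k, p.2)
    rw [Polynomial.eval_add, Polynomial.eval_C, Polynomial.eval_mul, Polynomial.eval_X,
      Polynomial.eval_C, linForm]
    simp only [transvectionMatrix, nilMatrix, Matrix.add_apply, Matrix.smul_apply, smul_eq_mul,
      map_add, map_mul, add_mul, Finset.sum_add_distrib, Finset.mul_sum, mul_assoc]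
    congr 1
    rw [Finset.sum_eq_single p.1]
    · simp
    · intro k _ hk
      rw [Matrix.one_apply_ne hk.symm, map_zero, zero_mul]
    · simp
  exact DFunLike.congr_fun this f

theorem coeff_zero_shear {n m : ℕ} (v : Fin n ⊕ Fin n → ℂ) (f : CoordRing n m) :
    (shear m v f).coeff 0 = f := by
  have h := eval_shear v 0 f
  have h0 : transvection 0 v = 1 := by
    apply Subtype.ext
    change transvectionMatrix 0 v = 1
    simp [transvectionMatrix]
  rwa [map_zero, h0, act_one, ← Polynomial.coeff_zero_eq_eval_zero] at h

/-- As $N^2=0$, differentiating $f((1+tN)X)$ amounts to evaluating the derivation at $(1+tN)X$,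
because $N(1+tN)=N$. -/
theorem derivative_shear {n m : ℕ} (v : Fin n ⊕ Fin n → ℂ) (f : CoordRing n m) :
    Polynomial.derivative (shear m v f) = shear m v (lieDer (Fin m ⊕ Fin m) (nilMatrix v) f) := by
  have hlin : ∀ (A : Matrix (Fin n ⊕ Fin n) (Fin n ⊕ Fin n) ℂ) (p), shear m v (linForm A p) =
      Polynomial.C (linForm A p) + Polynomial.X * Polynomial.C (linForm (A * nilMatrix v) p) := by
    intro A p
    have hC : ∀ c : ℂ, shear m v (C c) = Polynomial.C (C c) := fun c => (shear m v).commutes c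
    rw [← lieDer_linForm, linForm, map_sum, map_sum, map_sum]
    simp only [lieDer_C_mul, map_mul, hC, shear_X, lieDer_X, map_sum, Finset.mul_sum, mul_add,
      Finset.sum_add_distrib]
    refine congrArg (_ + ·) (Finset.sum_congr rfl fun k _ => mul_left_comm _ _ _)
  induction f using MvPolynomial.induction_on with
  | C a =>
    have hC : shear m v (C a) = Polynomial.C (C a) := (shear m v).commutes a
    rw [hC, Polynomial.derivative_C, derivation_C, map_zero]
  | add f g hf hg => rw [map_add, map_add, map_add, map_add, hf, hg]
  | mul_X f p hf =>
    rw [map_mul, Polynomial.derivative_mul, hf, Derivation.leibniz, lieDer_X, map_add, smul_eq_mul,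
      smul_eq_mul, map_mul, map_mul, hlin, nilMatrix_mul_self, shear_X]
    simp [linForm]
    ring

/-- A linear functional on the quotient by $I$ turns $G$ into a complex polynomial vanishing
everywhere, and functionals separate points. -/
theorem coeff_mem_of_eval_mem {P : Type*} [CommRing P] [Algebra ℂ P] (I : Ideal P)
    {G : Polynomial P} (h : ∀ c : ℂ, G.eval (algebraMap ℂ P c) ∈ I) (k : ℕ) : G.coeff k ∈ I := by
  rw [← Ideal.Quotient.eq_zero_iff_mem, ← Module.forall_dual_apply_eq_zero_iff ℂ]
  intro φ
  let ψ : P →ₗ[ℂ] ℂ := φ.comp (Ideal.Quotient.mkₐ ℂ I).toLinearMap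
  change ψ (G.coeff k) = 0
  let g : Polynomial ℂ := ∑ j ∈ Finset.range (G.natDegree + 1), Polynomial.monomial j (ψ (G.coeff j))
  have hg : g = 0 := by
    refine Polynomial.funext fun c => ?_
    have h1 : ψ (G.eval (algebraMap ℂ P c)) = 0 := by
      change φ (Ideal.Quotient.mk I _) = 0
      rw [Ideal.Quotient.eq_zero_iff_mem.2 (h c), map_zero]
    rw [Polynomial.eval_zero, ← h1, Polynomial.eval_finsetSum, Polynomial.eval_eq_sum_range,
      map_sum]
    refine Finset.sum_congr rfl fun j _ => ?_
    rw [Polynomial.eval_monomial, ← map_pow, mul_comm (G.coeff j), ← Algebra.smul_def, map_smul,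
      smul_eq_mul, mul_comm]
  have hk := congrArg (Polynomial.coeff · k) hg
  simp only [g, Polynomial.finsetSum_coeff, Polynomial.coeff_monomial, Polynomial.coeff_zero] at hk
  rw [Finset.sum_ite_eq'] at hk
  by_cases hkn : k ∈ Finset.range (G.natDegree + 1)
  · rwa [if_pos hkn] at hk
  · rw [Polynomial.coeff_eq_zero_of_natDegree_lt, map_zero]
    simpa using hkn

/-- The derivation is the linear coefficient of the shear, all of whose values at constants agree
with $f$ modulo $I$. -/
theorem lieDer_mem_of_act_sub_mem {n m : ℕ} {I : Ideal (CoordRing n m)} {f : CoordRing n m}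
    (h : ∀ g : Sp n, act m g f - f ∈ I) (v : Fin n ⊕ Fin n → ℂ) :
    lieDer (Fin m ⊕ Fin m) (nilMatrix v) f ∈ I := by
  have h1 := coeff_mem_of_eval_mem I (G := shear m v f - Polynomial.C f) (fun c => by
    rw [Polynomial.eval_sub, Polynomial.eval_C]
    exact eval_shear v c f ▸ h (transvection c v)) 1
  have h2 : (shear m v f).coeff 1 = lieDer (Fin m ⊕ Fin m) (nilMatrix v) f := by
    have := congrArg (Polynomial.coeff · 0) (derivative_shear v f)
    simpa [Polynomial.coeff_derivative, coeff_zero_shear] using this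
  simpa [h2, Polynomial.coeff_C] using h1

/-- The shear has zero derivative, so it is constant and transvections fix $f$; they generate the
group. -/
theorem act_eq_of_lieDer_eq_zero {n m : ℕ} {f : CoordRing n m}
    (h : ∀ v, lieDer (Fin m ⊕ Fin m) (nilMatrix v) f = 0) (g : Sp n) : act m g f = f := by
  have hg : g ∈ transvectionGroup n := by rw [transvectionGroup_eq_top]; trivial
  induction hg using Subgroup.closure_induction with
  | mem g hg =>
    obtain ⟨⟨c, v⟩, rfl⟩ := hg
    have h1 := derivative_shear v f
    rw [h, map_zero] at h1
    have h2 := Polynomial.eq_C_of_derivative_eq_zero h1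
    rw [coeff_zero_shear] at h2
    change act m (transvection c v) f = f
    rw [← eval_shear, h2, Polynomial.eval_C]
  | one => exact act_one f
  | mul g k _ _ hg hk => rw [act_mul, hg, hk]
  | inv g _ hg =>
    conv_lhs => rw [← hg]
    rw [← act_mul, mul_inv_cancel, act_one]

theorem lieDer_mem_momentIdeal {n m : ℕ} (v : Fin n ⊕ Fin n → ℂ) (f : CoordRing n m)
    (hf : f ∈ momentIdeal n m) : lieDer (Fin m ⊕ Fin m) (nilMatrix v) f ∈ momentIdeal n m :=
  lieDer_mem_of_act_sub_mem (fun g => sub_mem (momentIdeal_le_comap m g hf) hf) v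

theorem lieDer_mem_of_mk_mem_invariants {n m : ℕ} {f : CoordRing n m}
    (hf : Ideal.Quotient.mk (momentIdeal n m) f ∈ invariants n m) (v : Fin n ⊕ Fin n → ℂ) :
    lieDer (Fin m ⊕ Fin m) (nilMatrix v) f ∈ momentIdeal n m :=
  lieDer_mem_of_act_sub_mem
    (fun g => Ideal.Quotient.eq.1 (by rw [← actQuot_mk, mem_invariants.1 hf g])) v

/-! ### Proper ideals of invariants stay proper; surjectivity of the quotient map -/

/-- Leibniz: $f\,Dy=D(fy)-y\,Df$, and $Df\in\mathcal I_\mu$ because the class of $f$ is invariant.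
-/
theorem mul_mem_lieImage {n m : ℕ} {f s : CoordRing n m}
    (hf : Ideal.Quotient.mk (momentIdeal n m) f ∈ invariants n m) (hs : s ∈ lieImage n m) :
    ∃ i ∈ momentIdeal n m, f * s - i ∈ lieImage n m := by
  induction hs using Submodule.iSup_induction' with
  | mem v x hx =>
    obtain ⟨y, rfl⟩ := hx
    refine ⟨-(y * lieDer (Fin m ⊕ Fin m) (nilMatrix v) f), neg_mem (Ideal.mul_mem_left _ _
      (lieDer_mem_of_mk_mem_invariants hf v)), Submodule.mem_iSup_of_mem v ⟨f * y, ?_⟩⟩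
    simp only [Derivation.coeFn_coe, Derivation.leibniz, smul_eq_mul]
    ring
  | zero => exact ⟨0, zero_mem _, by simp⟩
  | add x y _ _ hx hy =>
    obtain ⟨i, hi, hix⟩ := hx
    obtain ⟨j, hj, hjy⟩ := hy
    refine ⟨i + j, add_mem hi hj, ?_⟩
    have := add_mem hix hjy
    convert this using 1
    ring

/-- The extension of a proper ideal of invariants to `ℂ[V] / I_μ` is proper. -/
theorem map_val_ne_top {n m : ℕ} {M : Ideal (invariants n m)} (hM : M ≠ ⊤) :
    M.map (invariants n m).val ≠ ⊤ := by
  intro htop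
  -- Every element of the extended ideal agrees with an element of $M$ up to the Lie image: in a
  -- product $rf$ with $f\in M$, the factor $r$ is replaced by its invariant part.
  have key : ∀ x ∈ M.map (invariants n m).val, ∃ y ∈ M, ∃ s ∈ lieImage n m,
      x - y.1 = Ideal.Quotient.mk (momentIdeal n m) s := by
    intro x hx
    induction hx using Submodule.closure_induction with
    | zero => exact ⟨0, zero_mem _, 0, zero_mem _, by simp⟩
    | add x x' _ _ hx hx' =>
      obtain ⟨y, hy, s, hs, h⟩ := hx
      obtain ⟨y', hy', s', hs', h'⟩ := hx'
      refine ⟨y + y', add_mem hy hy', s + s', add_mem hs hs', ?_⟩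
      rw [map_add, ← h, ← h', Subalgebra.coe_add]
      ring
    | smul_mem r x hx =>
      obtain ⟨f, hf, rfl⟩ := hx
      obtain ⟨r, rfl⟩ := Ideal.Quotient.mk_surjective r
      obtain ⟨r', hr', hrr'⟩ := exists_lieDer_eq_zero_sub_mem_lieImage r
      have hinv : Ideal.Quotient.mk (momentIdeal n m) r' ∈ invariants n m :=
        mem_invariants.2 fun g => by rw [actQuot_mk, act_eq_of_lieDer_eq_zero hr']
      obtain ⟨F, hF⟩ := Ideal.Quotient.mk_surjective f.1
      obtain ⟨i, hi, his⟩ := mul_mem_lieImage (f := F) (hF ▸ f.2) hrr'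
      refine ⟨⟨_, hinv⟩ * f, Ideal.mul_mem_left _ _ hf, _, his, ?_⟩
      rw [map_sub, Ideal.Quotient.eq_zero_iff_mem.2 hi, map_mul, map_sub, hF]
      change _ * f.1 - _ * f.1 = _
      ring
  obtain ⟨y, hy, s, hs, h⟩ := key 1 (by rw [htop]; trivial)
  obtain ⟨F, hF⟩ := Ideal.Quotient.mk_surjective (1 - y.1)
  have hFinv : Ideal.Quotient.mk (momentIdeal n m) F ∈ invariants n m := by
    rw [hF]
    exact sub_mem (one_mem _) y.2
  -- The class $1-y$ is invariant and lies in the Lie image modulo $\mathcal I_\mu$, so it vanishes;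
  -- hence $1=y\in M$.
  have hFI : F ∈ momentIdeal n m := by
    refine mem_of_mem_sup_lieImage _ lieDer_mem_momentIdeal (i := F - s) ?_ (by simpa using hs)
      (lieDer_mem_of_mk_mem_invariants hFinv)
    rw [← Ideal.Quotient.eq, hF, h]
  rw [← Ideal.Quotient.eq_zero_iff_mem, hF, sub_eq_zero] at hFI
  refine hM ((Ideal.eq_top_iff_one _).2 ?_)
  have : (1 : invariants n m) = y := Subtype.ext hFI
  rwa [this]

/-- The extension of a maximal ideal of invariants lies in a maximal ideal of $\mathbb C[V]/\mathcal
I_\mu$, which by the Nullstellensatz is a point $X$ of the zero fibre. The given ideal is contained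
in that of $\pi(X)$, and maximality gives equality. -/
theorem quotientMap_surjective (n m : ℕ) :
    Function.Surjective (quotientMap : ZeroFibre n m → Reduction n m) := by
  intro p
  obtain ⟨M, hM, hle⟩ := Ideal.exists_le_maximal _ (map_val_ne_top p.isMaximal.ne_top)
  have hcomap : (M.comap (Ideal.Quotient.mk (momentIdeal n m))).IsMaximal :=
    Ideal.comap_isMaximal_of_surjective _ Ideal.Quotient.mk_surjective
  obtain ⟨x, hx⟩ := isMaximal_iff_eq_vanishingIdeal_singleton.1 hcomap
  have hmem : ∀ f : CoordRing n m, Ideal.Quotient.mk (momentIdeal n m) f ∈ M → aeval x f = 0 := by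
    intro f hf
    rw [← mem_vanishingIdeal_singleton_iff, ← hx]
    exact hf
  let x' : Mat n m ℂ := of fun i j => x (i, j)
  have hX : momentMap x' = 0 := by
    ext A
    rw [← aeval_momentPoly]
    refine hmem _ ?_
    have hA : momentPoly m A ∈ momentIdeal n m := Ideal.subset_span ⟨A, rfl⟩
    rw [Ideal.Quotient.eq_zero_iff_mem.2 hA]
    exact zero_mem _
  refine ⟨⟨x', hX⟩, MaximalSpectrum.ext (p.isMaximal.eq_of_le ?_ fun f hf => ?_).symm⟩
  · exact (quotientMap (⟨x', hX⟩ : ZeroFibre n m)).isMaximal.ne_top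
  · obtain ⟨F, hF⟩ := Ideal.Quotient.mk_surjective f.1
    change evalAt _ f.1 = 0
    rw [← hF, evalAt_mk]
    refine hmem F ?_
    rw [hF]
    exact hle (Ideal.mem_map_of_mem _ hf)

end SpReduction

/-- The map `X ↦ Xᵀ J X Q` on `μ⁻¹(0)` factors through a unique map `ν` from the set of closed
points of `μ⁻¹(0) // Sp_{2n}` to `Z`, and this `ν` is bijective. -/
theorem mainTheorem5 (n m : ℕ) :
    ∃ ν : SpReduction.Reduction n m → SpReduction.Z n m,
      Function.Bijective ν ∧
      (∀ X : SpReduction.ZeroFibre n m,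
        (ν (SpReduction.quotientMap X)).1 =
          Matrix.transpose X.1 * SpReduction.J n * X.1 * SpReduction.Q m) ∧
      ∀ ν' : SpReduction.Reduction n m → SpReduction.Z n m,
        (∀ X : SpReduction.ZeroFibre n m,
          (ν' (SpReduction.quotientMap X)).1 =
            Matrix.transpose X.1 * SpReduction.J n * X.1 * SpReduction.Q m) → ν' = ν := by
  classical
  have hsurj := SpReduction.quotientMap_surjective n m
  let s := Function.surjInv hsurj
  have hs : ∀ p, SpReduction.quotientMap (s p) = p := Function.surjInv_eq hsurj
  -- Defined through an arbitrary section of $\pi$; the result is independent of the section because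
  -- $\pi$ determines the Gram matrix.
  let ν : SpReduction.Reduction n m → SpReduction.Z n m :=
    fun p => ⟨_, SpReduction.gram_mul_Q_mem_Z (s p)⟩
  have hν : ∀ X : SpReduction.ZeroFibre n m, (ν (SpReduction.quotientMap X)).1 =
      Matrix.transpose X.1 * SpReduction.J n * X.1 * SpReduction.Q m := fun X =>
    congrArg (· * SpReduction.Q m) ((SpReduction.quotientMap_eq_iff _ _).1 (hs _))
  refine ⟨ν, ⟨fun p p' h => ?_, fun A => ?_⟩, hν, fun ν' hν' => funext fun p => ?_⟩
  · obtain ⟨X, rfl⟩ := hsurj p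
    obtain ⟨Y, rfl⟩ := hsurj p'
    -- Multiplication by $Q$ recovers the Gram matrix, since $Q^2=1$.
    have h := congrArg (fun A => A.1 * SpReduction.Q m) h
    simp only [hν, Matrix.mul_assoc _ (SpReduction.Q m), SpReduction.Q_mul_Q, Matrix.mul_one] at h
    exact (SpReduction.quotientMap_eq_iff _ _).2 h
  · obtain ⟨X, hX⟩ := SpReduction.exists_zeroFibre_gram_eq A.2
    exact ⟨SpReduction.quotientMap X, Subtype.ext ((hν X).trans hX)⟩
  · obtain ⟨X, rfl⟩ := hsurj p
    exact Subtype.ext ((hν' X).trans (hν X).symm)
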